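/- Let $\mathcal X$ be a finite set, let $1 \le n_0 \le n$ be integers, and let $k_{n_0}, \dots, k_n \ge 0$ be integers, fixed in advance, with $k = \sum_{\tau=n_0}^{n} k_\tau \ge 1$. A statistical query is a function $q : \mathcal X \to [0,1]$; for $x \in \mathcal X^t$ put $q(x) = \frac1t\sum_{i=1}^t q(x_i)$, and for a probability distribution $\mathcal P$ on $\mathcal X$ put $q(\mathcal P^t) = \mathbb E_{X \sim \mathcal P^t}[q(X)]$. For $\sigma > 0$ the clipped Gaussian mechanism $\mathsf M_\sigma$ answers a query $q$ on a data set $x$ by $\max(0, \min(q(x) + z, 1))$ with fresh noise $z \sim \mathcal N(0, \sigma^2)$. A growing data set $X = (X_1, \dots, X_n) \sim \mathcal P^n$ is analysed in rounds $t = n_0, \dots, n$. In round $t$ a randomized analyst submits $k_t$ statistical queries one after another, each drawn from a distribution that depends only on all previous queries and responses (the transcript so far), and each is answered by $\mathsf M_\sigma$ on the snapshot $(X_1, \dots, X_t)$ before the next one is chosen. For $\alpha \ge 0$ and $\beta' \in (0,1)$, the mechanism is called $(\alpha, \beta')$-distributionally accurate if for every analyst and every $\mathcal P$, with probability at least $1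 - \beta'$ over data set and transcript, $|R - Q(\mathcal P^t)| \le \alpha$ holds simultaneously for all rounds $t$ and all query-response pairs $(Q, R)$ of round $t$. For $\sigma > 0$, $\epsilon \ge 0$ and $t \in \{1, \dots, n\}$ let $$\vec\rho(t) = \sum_{\tau = n_0}^{n} \frac{k_\tau \mathbf 1\{t \le \tau\}}{2 \sigma^2 \tau^2}, \qquad \psi(\gamma, \rho, \epsilon) = \frac{e^{(\gamma - 1)(\gamma\rho - \epsilon)} (1 - \gamma^{-1})^{\gamma}}{\gamma - 1}, \qquad \vec\delta(t) = \psi(\gamma^\star, \vec\rho(t), \epsilon),$$ where $\gamma^\star$ is the unique minimizer of $\gamma \mapsto \psi(\gamma, \max_{1 \le s \le n} \vec\rho(s), \epsilon)$ over $(1, \infty)$. Let $\Theta = \{(\sigma, \beta, \epsilon) \in \mathbb R^3 : \sigma > 0,\ 0 < \beta < 1,\ \epsilon \ge 0\}$, fix $\beta' \in (0,1)$, and for $(\sigma,\beta,\epsilon) \in \Theta$ let $$\lambda(\sigma, \beta, \epsilon) = \sqrt 2\, \sigma\, \mathrm{erfc}^{-1}\!\left(\frac{\beta}{k}\right) + e^{\epsilon}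 - 1 + \frac{\beta}{\beta'} + \frac{2 \sum_{\tau=1}^{n} \vec\delta(\tau)}{n_0 \beta'} + \frac{2}{\beta'} \sqrt{\frac{2 \beta \sum_{\tau=1}^{n} \vec\delta(\tau)}{n_0}}, \qquad \alpha' = \inf_{\Theta} \lambda .$$ Then: 1. for every $(\sigma, \beta, \epsilon) \in \Theta$, the mechanism $\mathsf M_\sigma$ is $(\lambda(\sigma, \beta, \epsilon), \beta')$-distributionally accurate; 2. if $\alpha' < 1$, the infimum is attained, so that $\alpha' = \min_{\Theta} \lambda$; 3. for a suitable $\sigma > 0$ (by 1, the $\sigma$-component of any minimizer of $\lambda$, if there is one), $\mathsf M_\sigma$ is $(\alpha', \beta')$-distributionally accurate. -/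

import Mathlib

open MeasureTheory ProbabilityTheory
open scoped ENNReal NNReal

noncomputable section

namespace GrowingADA

/-! ### Statistical queries and snapshots -/

/-- A statistical query on the domain `X` is given by a function `X → [0, 1]`. -/
abbrev StatQuery (X : Type*) := X → Set.Icc (0 : ℝ) 1

/-- The value of a statistical query on a data set of size `m`: the empirical mean. -/
def evalOn {X : Type*} {m : ℕ} (q : StatQuery X) (y : Fin m → X) : ℝ :=
  (∑ i, (q (y i) : ℝ)) / m

/-- The value of the query on the distribution `P ^ t`, the law of `t` i.i.d. data points. -/
def popValue {X : Type*} [MeasurableSpace X] (q : StatQuery X) (P : Measure X) (t : ℕ) : ℝ :=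
  ∫ y, evalOn q y ∂(Measure.pi fun _ : Fin t => P)

/-- The first `t` data points of a growing data set with horizon `n` (all of it if `n ≤ t`). -/
def snapshot {X : Type*} {n : ℕ} (x : Fin n → X) (t : ℕ) : Fin (min t n) → X :=
  fun i => x (Fin.castLE (min_le_right t n) i)

/-! ### Mechanism, analyst and their interaction -/

/-- A mechanism answers a query at random, using a snapshot `y` of any size `m`. The size of the
snapshot is also the index of the current round. -/
structure Mechanism (X : Type*) where
  answer : ∀ m : ℕ, (Fin m → X) → Kernel (StatQuery X) ℝ
  markov : ∀ m y, IsMarkovKernel (answer m y)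

/-- A randomized analyst chooses the next query from the transcript of the `i` previous
query-response pairs. -/
structure Analyst (X : Type*) where
  query : ∀ i : ℕ, Kernel (Fin i → StatQuery X × ℝ) (StatQuery X)
  markov : ∀ i, IsMarkovKernel (query i)

/-- If `kk τ` queries are asked in each round `τ ≥ n₀`, then this is the round in which the
query number `i` (counted from `0`) is asked. -/
def roundOf (n₀ : ℕ) (kk : ℕ → ℕ) (i : ℕ) : ℕ :=
  sInf {t | i < ∑ τ ∈ Finset.Icc n₀ t, kk τ}

/-- The law of the first `m` query-response pairs when the analyst `A` interacts with `M` on the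
growing data set `x`: in each step the analyst picks `Q` from the transcript so far, the
mechanism draws the response `R` from `Q` and the snapshot of the current round, and `(Q, R)` is
appended to the transcript. -/
def interact {X : Type*} {n : ℕ} (M : Mechanism X) (A : Analyst X) (n₀ : ℕ) (kk : ℕ → ℕ)
    (x : Fin n → X) : (m : ℕ) → Measure (Fin m → StatQuery X × ℝ)
  | 0 => Measure.dirac Fin.elim0
  | m + 1 =>
    (interact M A n₀ kk x m ⊗ₘ
      (A.query m ⊗ₖ Kernel.prodMkLeft (Fin m → StatQuery X × ℝ)
        (M.answer _ (snapshot x (roundOf n₀ kk m))))).map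
      (fun p => Fin.snoc (α := fun _ => StatQuery X × ℝ) p.1 p.2)

instance isProbabilityMeasure_interact {X : Type*} {n : ℕ} (M : Mechanism X) (A : Analyst X)
    (n₀ : ℕ) (kk : ℕ → ℕ) (x : Fin n → X) (m : ℕ) :
    IsProbabilityMeasure (interact M A n₀ kk x m) := by
  induction m with
  | zero => unfold interact; infer_instance
  | succ m ih =>
    unfold interact
    have := A.markov m
    have := M.markov _ (snapshot x (roundOf n₀ kk m))
    refine Measure.isProbabilityMeasure_map (Measurable.aemeasurable ?_)
    refine measurable_pi_lambda _ fun i => ?_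
    refine Fin.lastCases ?_ (fun j => ?_) i
    · simpa using measurable_snd
    · simp only [Fin.snoc_castSucc]
      fun_prop

/-- The total number of queries, all of which are asked in the rounds `n₀, …, n`. -/
def totalQueries (n₀ n : ℕ) (kk : ℕ → ℕ) : ℕ := ∑ τ ∈ Finset.Icc n₀ n, kk τ

/-- The joint law of the data set, drawn from `P ^ n`, and of the transcript. -/
def jointLaw {X : Type*} [Finite X] [MeasurableSpace X] [MeasurableSingletonClass X]
    (M : Mechanism X) (A : Analyst X) (n₀ n : ℕ) (kk : ℕ → ℕ) (P : Measure X) :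
    Measure ((Fin n → X) × (Fin (totalQueries n₀ n kk) → StatQuery X × ℝ)) :=
  (Measure.pi fun _ : Fin n => P) ⊗ₘ
    Kernel.ofFunOfCountable fun x => interact M A n₀ kk x (totalQueries n₀ n kk)

/-- `({α t}, β)`-distributional accuracy, when `kk τ` queries are asked in round `τ`: for every
analyst and every data distribution, with probability at least `1 - β`, all responses `R` to
queries `Q` of a round `t` satisfy `|R - Q(P ^ t)| ≤ α t`, jointly for all rounds. -/
def DistAccurate {X : Type*} [Finite X] [MeasurableSpace X] [MeasurableSingletonClass X]
    (M : Mechanism X) (n₀ n : ℕ) (kk : ℕ → ℕ) (α : ℕ → ℝ) (β : ℝ) : Prop :=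
  ∀ (A : Analyst X) (P : Measure X), IsProbabilityMeasure P →
    1 - β ≤ (jointLaw M A n₀ n kk P).real
      {p | ∀ t ∈ Finset.Icc n₀ n, ∀ i : Fin (totalQueries n₀ n kk), roundOf n₀ kk i = t →
        |(p.2 i).2 - popValue (p.2 i).1 P t| ≤ α t}

/-! ### The clipped Gaussian mechanism -/

/-- Clamping to `[0, 1]`. -/
def clamp (r : ℝ) : ℝ := max 0 (min r 1)

/-- The answer `clamp (q(y) + z)` with `z ∼ N(0, s ^ 2)`, as a kernel in the query `q`. -/
def clippedGaussianKernel {X : Type*} (s : ℝ) {m : ℕ} (y : Fin m → X) :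
    Kernel (StatQuery X) ℝ :=
  (Kernel.id ×ₖ Kernel.const (StatQuery X) (gaussianReal 0 (s ^ 2).toNNReal)).map
    (fun p => clamp (evalOn p.1 y + p.2))

theorem measurable_clippedGaussian {X : Type*} {m : ℕ} (y : Fin m → X) :
    Measurable (fun p : StatQuery X × ℝ => clamp (evalOn p.1 y + p.2)) := by
  unfold clamp evalOn
  fun_prop

/-- The clipped Gaussian mechanism with standard deviation `σ t` in round `t`. -/
def clippedGaussian (X : Type*) (σ : ℕ → ℝ) : Mechanism X where
  answer m y := clippedGaussianKernel (σ m) y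
  markov _ y := Kernel.IsMarkovKernel.map _ (measurable_clippedGaussian y)

/-! ### The error bound -/

/-- The complementary error function. -/
def erfc (x : ℝ) : ℝ := 2 / √Real.pi * ∫ t in Set.Ioi x, Real.exp (-t ^ 2)

/-- The inverse of the complementary error function, which maps `ℝ` onto `(0, 2)`. -/
def erfcInv : ℝ → ℝ := Function.invFun erfc

/-- The non-uniform zCDP parameter of the data point `t`. -/
def rho (n₀ n : ℕ) (kk : ℕ → ℕ) (σ : ℕ → ℝ) (t : ℕ) : ℝ :=
  ∑ τ ∈ Finset.Icc n₀ n, kk τ * (if t ≤ τ then 1 else 0) / (2 * σ τ ^ 2 * (τ : ℝ) ^ 2)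

def psi (γ ρ ε : ℝ) : ℝ :=
  Real.exp ((γ - 1) * (γ * ρ - ε)) * (1 - γ⁻¹) ^ γ / (γ - 1)

/-- The minimizer of `psi · ρ ε` over `(1, ∞)`, which exists and is unique if `ρ > 0`. -/
def gammaStar (ρ ε : ℝ) : ℝ :=
  Classical.epsilon fun γ => γ ∈ Set.Ioi (1 : ℝ) ∧ IsMinOn (fun g => psi g ρ ε) (Set.Ioi 1) γ

/-- The non-uniform parameter `δ(t)` of approximate differential privacy. -/
def delta (n₀ n : ℕ) (kk : ℕ → ℕ) (σ : ℕ → ℝ) (ε : ℝ) (t : ℕ) : ℝ :=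
  psi (gammaStar (sSup (rho n₀ n kk σ '' Set.Icc 1 n)) ε) (rho n₀ n kk σ t) ε

/-- The parameters `(σ, β, ε)`. -/
def Theta : Set (ℝ × ℝ × ℝ) := {p | 0 < p.1 ∧ (0 < p.2.1 ∧ p.2.1 < 1) ∧ 0 ≤ p.2.2}

/-- The error bound `λ(σ, β, ε)`, for the confidence parameter `β'`. -/
def errBound (n₀ n : ℕ) (kk : ℕ → ℕ) (β' : ℝ) : ℝ × ℝ × ℝ → ℝ := fun (σ, β, ε) =>
  √2 * σ * erfcInv (β / totalQueries n₀ n kk) + Real.exp ε - 1 + β / β'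
    + 2 * (∑ τ ∈ Finset.Icc 1 n, delta n₀ n kk (fun _ => σ) ε τ) / (n₀ * β')
    + 2 / β' * √(2 * β * (∑ τ ∈ Finset.Icc 1 n, delta n₀ n kk (fun _ => σ) ε τ) / n₀)

end GrowingADA

end

open MeasureTheory ProbabilityTheory
open scoped ENNReal NNReal

noncomputable section

namespace GrowingADA

/-! Differential privacy of the transcript forces its queries to generalize. Exchanging one data
point moves the mean of a Gaussian answer in round `τ` by at most `1 / τ`, and not at all if the
point is outside the snapshot. The resulting Rényi bound is used in the dual form `HolderDom`, for
which post-processing is immediate and adaptive composition multiplies constants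
(`HolderDom.compProd`). Over the whole interaction the exponents add up to `rho`, and Young's
inequality (`exp_mul_rpow_le_psi`) turns this into approximate privacy with its own `δ` for each
data point (`integral_interact_le`).

Let `B` be the event that some response is off the population value by more than `a`. A selector
picks, from the transcript alone, an offending query and the sign of its error; this is again a
private output. Exchanging data points for independent copies shows that the empirical and
population means of the selected query differ, integrated over `B`, by at most `(e^ε - 1) P(B) + (∑
δ) / n₀` (`sum_integral_query_le`). Responses stay within `α = √2 σ erfcInv (β / k)` of the
empirical means outside an event of probability `β`. Hence `(a - α - (e^ε - 1)) P(B) ≤ β + (∑ δ) /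
n₀`, and `a = λ` gives `P(B) ≤ β'`; the factor `2` and the square root in `λ` are slack.

For attainment, `λ` is continuous on `Theta`, because `gammaStar` is the zero of a strictly
increasing function depending continuously on the parameters. All parts of `λ` are nonnegative, so
`λ < 1` confines the parameters to a compact box. If `α' ≥ 1`, accuracy is trivial, since clipped
answers are off by at most `1`. -/

/-! ### Hölder domination, a dual form of a bound on the Rényi divergence -/

/-- `μ` is dominated by `ν` in the dual of `L ^ r`, with constant `c`. This bounds the Rényi
divergence of `μ` from `ν` whose order is the conjugate exponent of `r`. -/
def HolderDom {Ω : Type*} [MeasurableSpace Ω] (r : ℝ) (c : ℝ≥0∞) (μ ν : Measure Ω) : Prop :=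
  ∀ f : Ω → ℝ≥0∞, Measurable f → ∫⁻ ω, f ω ∂μ ≤ c * (∫⁻ ω, f ω ^ r ∂ν) ^ (1 / r)

theorem HolderDom.map {Ω Ω' : Type*} [MeasurableSpace Ω] [MeasurableSpace Ω'] {r : ℝ} {c : ℝ≥0∞}
    {μ ν : Measure Ω} (h : HolderDom r c μ ν) {g : Ω → Ω'} (hg : Measurable g) :
    HolderDom r c (μ.map g) (ν.map g) := by
  intro f hf
  rw [lintegral_map hf hg, lintegral_map (hf.pow_const r) hg]
  exact h _ (hf.comp hg)

/-- The inner bound leaves the function `ω ↦ (∫ f ^ r ∂η ω) ^ (1 / r)`, and its `r`-th power is the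
inner integral again, so the outer bound closes the argument. No densities are needed. -/
theorem HolderDom.compProd {Ω Ω' : Type*} [MeasurableSpace Ω] [MeasurableSpace Ω'] {r : ℝ}
    (hr : 0 < r) {c d : ℝ≥0∞} {μ ν : Measure Ω} [SFinite μ] [SFinite ν] {κ η : Kernel Ω Ω'}
    [IsSFiniteKernel κ] [IsSFiniteKernel η]
    (h : HolderDom r c μ ν) (h' : ∀ ω, HolderDom r d (κ ω) (η ω)) :
    HolderDom r (c * d) (μ ⊗ₘ κ) (ν ⊗ₘ η) := by
  intro f hf
  rw [Measure.lintegral_compProd hf, Measure.lintegral_compProd (hf.pow_const r)]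
  have hm : Measurable fun ω => ∫⁻ ω', f (ω, ω') ^ r ∂η ω :=
    Measurable.lintegral_kernel_prod_right (f := fun ω ω' => f (ω, ω') ^ r) (hf.pow_const r)
  calc ∫⁻ ω, ∫⁻ ω', f (ω, ω') ∂κ ω ∂μ
      ≤ ∫⁻ ω, d * (∫⁻ ω', f (ω, ω') ^ r ∂η ω) ^ (1 / r) ∂μ :=
        lintegral_mono fun ω => h' ω _ (hf.comp measurable_prodMk_left)
    _ = d * ∫⁻ ω, (∫⁻ ω', f (ω, ω') ^ r ∂η ω) ^ (1 / r) ∂μ :=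
        lintegral_const_mul _ (hm.pow_const _)
    _ ≤ d * (c * (∫⁻ ω, ((∫⁻ ω', f (ω, ω') ^ r ∂η ω) ^ (1 / r)) ^ r ∂ν) ^ (1 / r)) := by
        gcongr
        exact h _ (hm.pow_const _)
    _ = c * d * (∫⁻ ω, ∫⁻ ω', f (ω, ω') ^ r ∂η ω ∂ν) ^ (1 / r) := by
        simp_rw [← ENNReal.rpow_mul, one_div_mul_cancel hr.ne', ENNReal.rpow_one]
        ring

theorem HolderDom.refl {Ω : Type*} [MeasurableSpace Ω] {γ r : ℝ} (h : γ.HolderConjugate r)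
    (μ : Measure Ω) [IsProbabilityMeasure μ] : HolderDom r 1 μ μ := by
  intro f hf
  have := ENNReal.lintegral_mul_le_Lp_mul_Lq μ h (f := fun _ => 1) (g := f)
    aemeasurable_const hf.aemeasurable
  simpa using this

theorem HolderDom.mono {Ω : Type*} [MeasurableSpace Ω] {r : ℝ} {c d : ℝ≥0∞} (hcd : c ≤ d)
    {μ ν : Measure Ω} (h : HolderDom r c μ ν) : HolderDom r d μ ν :=
  fun f hf => (h f hf).trans (by gcongr)

/-- Hölder's inequality for `f` times the likelihood ratio; the constant is the `L ^ γ` norm of that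
ratio. -/
theorem holderDom_gaussianReal {γ r : ℝ} (h : γ.HolderConjugate r) (a b : ℝ) {v : ℝ≥0}
    (hv : v ≠ 0) : HolderDom r (ENNReal.ofReal (Real.exp ((γ - 1) * ((a - b) ^ 2 / (2 * v)))))
      (gaussianReal a v) (gaussianReal b v) := by
  intro f hf
  have hv' : (v : ℝ) ≠ 0 := by exact_mod_cast hv
  have hγ := h.pos
  set L : ℝ → ℝ := fun z => (a - b) * (2 * z - a - b) / (2 * v) with hL
  have hLm : Measurable fun z => ENNReal.ofReal (Real.exp (L z)) := by fun_prop
  have h1 : ∫⁻ z, f z ∂gaussianReal a v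
      = ∫⁻ z, (f * fun z => ENNReal.ofReal (Real.exp (L z))) z ∂gaussianReal b v := by
    rw [gaussianReal_of_var_ne_zero _ hv, gaussianReal_of_var_ne_zero _ hv,
      lintegral_withDensity_eq_lintegral_mul _ (measurable_gaussianPDF _ _) hf,
      lintegral_withDensity_eq_lintegral_mul _ (measurable_gaussianPDF _ _) (hf.mul hLm)]
    refine lintegral_congr fun z => ?_
    have : gaussianPDF a v z = gaussianPDF b v z * ENNReal.ofReal (Real.exp (L z)) := by
      rw [gaussianPDF, gaussianPDF, ← ENNReal.ofReal_mul (gaussianPDFReal_nonneg _ _ _),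
        gaussianPDFReal, gaussianPDFReal, mul_assoc _ _ (Real.exp (L z)), ← Real.exp_add]
      congr 3
      simp only [hL]
      field_simp
      ring
    simp only [Pi.mul_apply, this]
    ring
  have h2 : ∫⁻ z, ENNReal.ofReal (Real.exp (L z)) ^ γ ∂gaussianReal b v
      = ENNReal.ofReal (Real.exp (γ * (γ - 1) * ((a - b) ^ 2 / (2 * v)))) := by
    rw [gaussianReal_of_var_ne_zero _ hv,
      lintegral_withDensity_eq_lintegral_mul _ (measurable_gaussianPDF _ _) (hLm.pow_const _)]
    -- Completing the square: tilting by the `γ`-th power of the likelihood ratio moves the mean to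
    -- `b + γ (a - b)`.
    have : ∀ z, (gaussianPDF b v * fun z => ENNReal.ofReal (Real.exp (L z)) ^ γ) z
        = ENNReal.ofReal (Real.exp (γ * (γ - 1) * ((a - b) ^ 2 / (2 * v))))
          * gaussianPDF (b + γ * (a - b)) v z := by
      intro z
      rw [Pi.mul_apply, ENNReal.ofReal_rpow_of_pos (Real.exp_pos _), ← Real.exp_mul,
        gaussianPDF, gaussianPDF, ← ENNReal.ofReal_mul (gaussianPDFReal_nonneg _ _ _),
        ← ENNReal.ofReal_mul (Real.exp_pos _).le, gaussianPDFReal, gaussianPDFReal, mul_assoc,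
        mul_left_comm (Real.exp _), ← Real.exp_add, ← Real.exp_add]
      congr 3
      simp only [hL]
      field_simp
      ring
    simp_rw [this]
    rw [lintegral_const_mul _ (measurable_gaussianPDF _ _), lintegral_gaussianPDF_eq_one _ hv,
      mul_one]
  rw [h1]
  refine (ENNReal.lintegral_mul_le_Lp_mul_Lq _ h.symm hf.aemeasurable
    hLm.aemeasurable).trans_eq ?_
  rw [h2, mul_comm, ENNReal.ofReal_rpow_of_pos (Real.exp_pos _), ← Real.exp_mul]
  congr 3
  field_simp

/-- Young's inequality in the form that turns Hölder domination into approximate privacy. -/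
theorem exp_mul_rpow_le_psi {γ ρ ε v : ℝ} (hγ : 1 < γ) (hv : 0 ≤ v) :
    Real.exp ((γ - 1) * ρ) * v ^ (1 - γ⁻¹) ≤ Real.exp ε * v + psi γ ρ ε := by
  have hγ0 : 0 < γ := by linarith
  have hw : 0 < 1 - γ⁻¹ := by
    have := inv_lt_one_of_one_lt₀ hγ
    linarith
  have hw' : 1 - γ⁻¹ = (γ - 1) / γ := by field_simp
  have hpsi : 0 < psi γ ρ ε :=
    div_pos (mul_pos (Real.exp_pos _) (Real.rpow_pos_of_pos hw _)) (by linarith)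
  -- The two points are chosen so that the arithmetic mean is the right-hand side and the powers of
  -- `1 - γ⁻¹` cancel in the geometric mean.
  have key := Real.geom_mean_le_arith_mean2_weighted (w₁ := γ⁻¹) (w₂ := 1 - γ⁻¹)
    (p₁ := γ * psi γ ρ ε) (p₂ := Real.exp ε * v / (1 - γ⁻¹)) (by positivity) hw.le (by positivity)
    (by positivity) (by ring)
  have e1 : γ⁻¹ * (γ * psi γ ρ ε) + (1 - γ⁻¹) * (Real.exp ε * v / (1 - γ⁻¹))
      = Real.exp ε * v + psi γ ρ ε := by
    rw [inv_mul_cancel_left₀ hγ0.ne', mul_div_cancel₀ _ hw.ne', add_comm]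
  have e2 : γ * psi γ ρ ε = Real.exp ((γ - 1) * (γ * ρ - ε)) * (1 - γ⁻¹) ^ (γ - 1) := by
    rw [psi, Real.rpow_sub hw, Real.rpow_one]
    rw [hw']
    have : γ - 1 ≠ 0 := by linarith
    field_simp
  rw [e1, e2, Real.mul_rpow (Real.exp_pos _).le (by positivity),
    Real.div_rpow (by positivity) hw.le, Real.mul_rpow (Real.exp_pos _).le hv, ← Real.exp_mul,
    ← Real.exp_mul, ← Real.rpow_mul hw.le] at key
  refine le_of_eq_of_le ?_ key
  have e3 : (γ - 1) * γ⁻¹ = 1 - γ⁻¹ := by field_simp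
  have hne : (1 - γ⁻¹) ^ (1 - γ⁻¹) ≠ 0 := (Real.rpow_pos_of_pos hw _).ne'
  have e4 : Real.exp ((γ - 1) * ρ)
      = Real.exp ((γ - 1) * (γ * ρ - ε) * γ⁻¹) * Real.exp (ε * (1 - γ⁻¹)) := by
    rw [← Real.exp_add]
    congr 1
    field_simp
    ring
  rw [e3, e4]
  generalize (1 - γ⁻¹) ^ (1 - γ⁻¹) = u at *
  field_simp

/-- Hölder domination implies approximate differential privacy. -/
theorem HolderDom.integral_le {Ω : Type*} [MeasurableSpace Ω] {μ ν : Measure Ω}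
    [IsProbabilityMeasure μ] [IsProbabilityMeasure ν] {γ r ρ : ℝ} (ε : ℝ)
    (hγ : γ.HolderConjugate r)
    (h : HolderDom r (ENNReal.ofReal (Real.exp ((γ - 1) * ρ))) μ ν) {f : Ω → ℝ}
    (hf : Measurable f) (hf01 : ∀ ω, f ω ∈ Set.Icc (0 : ℝ) 1) :
    ∫ ω, f ω ∂μ ≤ Real.exp ε * ∫ ω, f ω ∂ν + psi γ ρ ε := by
  have hr := hγ.symm.pos
  have h0 : 0 ≤ ∫ ω, f ω ∂ν := integral_nonneg fun ω => (hf01 ω).1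
  have hintegr : Integrable f ν := Integrable.of_bound hf.aestronglyMeasurable 1
    (.of_forall fun ω => by rw [Real.norm_of_nonneg (hf01 ω).1]; exact (hf01 ω).2)
  refine le_trans ?_ (exp_mul_rpow_le_psi hγ.lt h0)
  rw [integral_eq_lintegral_of_nonneg_ae (.of_forall fun ω => (hf01 ω).1)
    hf.aestronglyMeasurable]
  refine ENNReal.toReal_le_of_le_ofReal (by positivity) ?_
  refine (h _ hf.ennreal_ofReal).trans ?_
  rw [ENNReal.ofReal_mul (Real.exp_pos _).le]
  gcongr
  have hexp : 1 - γ⁻¹ = 1 / r := by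
    have := hγ.inv_add_inv_eq_one
    rw [one_div]
    linarith
  rw [hexp, ← ENNReal.ofReal_rpow_of_nonneg h0 (by positivity)]
  refine ENNReal.rpow_le_rpow ?_ (by positivity)
  rw [ofReal_integral_eq_lintegral_ofReal hintegr (.of_forall fun ω => (hf01 ω).1)]
  refine lintegral_mono fun ω => ?_
  rw [ENNReal.ofReal_rpow_of_nonneg (hf01 ω).1 hr.le]
  refine ENNReal.ofReal_le_ofReal ?_
  -- For values in `[0, 1]` the power `r > 1` can be dropped.
  exact Real.rpow_le_self_of_le_one (hf01 ω).1 (hf01 ω).2 hγ.symm.lt.le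

/-! ### The interaction of analyst and mechanism -/

theorem measurable_snoc {Ω : Type*} [MeasurableSpace Ω] (m : ℕ) :
    Measurable fun p : (Fin m → Ω) × Ω => Fin.snoc (α := fun _ => Ω) p.1 p.2 := by
  refine measurable_pi_lambda _ fun i => ?_
  refine Fin.lastCases ?_ (fun j => ?_) i
  · simpa using measurable_snd
  · simp only [Fin.snoc_castSucc]
    fun_prop

/-- The response depends on the past only through the query, so for a fixed transcript one step is a
composition of a measure with a kernel. -/
theorem compProd_prodMkLeft_apply {Ω Ω₁ Ω₂ : Type*} [MeasurableSpace Ω] [MeasurableSpace Ω₁]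
    [MeasurableSpace Ω₂] (κ : Kernel Ω Ω₁) [IsSFiniteKernel κ] (η : Kernel Ω₁ Ω₂)
    [IsSFiniteKernel η] (ω : Ω) : (κ ⊗ₖ Kernel.prodMkLeft Ω η) ω = κ ω ⊗ₘ η := by
  rw [Kernel.compProd_apply_eq_compProd_sectR]
  congr 1

section Interact

variable {X : Type*} {n : ℕ} (M : Mechanism X) (A : Analyst X) (n₀ : ℕ) (kk : ℕ → ℕ)

/-- Adaptive composition: the analyst's choice has the same law given the same transcript and costs
a factor `1`; only the answer pays `exp (c i)`. -/
theorem holderDom_interact (x x' : Fin n → X) {γ r : ℝ} (hγ : γ.HolderConjugate r) (c : ℕ → ℝ)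
    (m : ℕ) (h : ∀ i < m, ∀ q, HolderDom r (ENNReal.ofReal (Real.exp (c i)))
      (M.answer _ (snapshot x (roundOf n₀ kk i)) q)
      (M.answer _ (snapshot x' (roundOf n₀ kk i)) q)) :
    HolderDom r (ENNReal.ofReal (Real.exp (∑ i ∈ Finset.range m, c i)))
      (interact M A n₀ kk x m) (interact M A n₀ kk x' m) := by
  induction m with
  | zero => simpa [interact] using HolderDom.refl hγ _
  | succ m ih =>
    have := A.markov m
    have := M.markov _ (snapshot x (roundOf n₀ kk m))
    have := M.markov _ (snapshot x' (roundOf n₀ kk m))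
    rw [Finset.sum_range_succ, Real.exp_add, ENNReal.ofReal_mul (Real.exp_pos _).le]
    refine HolderDom.map ?_ (measurable_snoc m)
    refine HolderDom.compProd hγ.symm.pos (ih fun i hi => h i (by omega)) fun p => ?_
    rw [compProd_prodMkLeft_apply, compProd_prodMkLeft_apply, ← one_mul (ENNReal.ofReal _)]
    exact HolderDom.compProd hγ.symm.pos (HolderDom.refl hγ _) (h m (by omega))

/-- The union bound for the responses of a mechanism. -/
theorem interact_exists_le (x : Fin n → X) (S : ℕ → Set (StatQuery X × ℝ))
    (hS : ∀ i, MeasurableSet (S i)) (b : ℝ≥0∞) (m : ℕ)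
    (h : ∀ i < m, ∀ q, M.answer _ (snapshot x (roundOf n₀ kk i)) q {r | (q, r) ∈ S i} ≤ b) :
    interact M A n₀ kk x m {p | ∃ i : Fin m, p i ∈ S i} ≤ m * b := by
  induction m with
  | zero => simp
  | succ m ih =>
    have := A.markov m
    have := M.markov _ (snapshot x (roundOf n₀ kk m))
    have hmeas : MeasurableSet
        {p : Fin (m + 1) → StatQuery X × ℝ | ∃ i : Fin (m + 1), p i ∈ S i} := by
      rw [Set.ofPred_exists]
      exact MeasurableSet.iUnion fun i => measurable_pi_apply i (hS i)
    have hmeas' : MeasurableSet {p : Fin m → StatQuery X × ℝ | ∃ i : Fin m, p i ∈ S i} := by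
      rw [Set.ofPred_exists]
      exact MeasurableSet.iUnion fun i => measurable_pi_apply i (hS i)
    rw [interact, Measure.map_apply (measurable_snoc m) hmeas]
    set κ := A.query m ⊗ₖ Kernel.prodMkLeft (Fin m → StatQuery X × ℝ)
      (M.answer _ (snapshot x (roundOf n₀ kk m))) with hκ
    have hsub : (fun p : (Fin m → StatQuery X × ℝ) × StatQuery X × ℝ =>
          Fin.snoc (α := fun _ => StatQuery X × ℝ) p.1 p.2) ⁻¹' {p | ∃ i : Fin (m + 1), p i ∈ S i}
        ⊆ Prod.fst ⁻¹' {p | ∃ i : Fin m, p i ∈ S i} ∪ Prod.snd ⁻¹' S m := by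
      rintro ⟨p, z⟩ ⟨i, hi⟩
      induction i using Fin.lastCases with
      | last => right; simpa using hi
      | cast i => left; exact ⟨i, by simpa using hi⟩
    have h1 : (interact M A n₀ kk x m ⊗ₘ κ) (Prod.fst ⁻¹' {p | ∃ i : Fin m, p i ∈ S i})
        ≤ m * b := by
      rw [← Measure.fst_apply hmeas', Measure.fst_compProd]
      exact ih fun i hi => h i (by omega)
    have h2 : (interact M A n₀ kk x m ⊗ₘ κ) (Prod.snd ⁻¹' S m) ≤ b := by
      rw [Measure.compProd_apply (measurable_snd (hS m))]
      refine (lintegral_mono fun p => ?_).trans_eq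
        (by simp : ∫⁻ _, b ∂interact M A n₀ kk x m = b)
      rw [hκ, compProd_prodMkLeft_apply]
      change ((A.query m p) ⊗ₘ _) (S m) ≤ b
      rw [Measure.compProd_apply (hS m)]
      exact (lintegral_mono fun q => h m (by omega) q).trans_eq (by simp)
    calc _ ≤ _ := measure_mono hsub
      _ ≤ _ := measure_union_le _ _
      _ ≤ m * b + b := add_le_add h1 h2
      _ = _ := by push_cast; ring

end Interact

/-! ### The clipped Gaussian kernel -/

theorem measurable_clamp : Measurable clamp := by
  unfold clamp
  fun_prop

theorem measurable_clamp_add (a : ℝ) : Measurable fun z => clamp (a + z) :=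
  measurable_clamp.comp (measurable_const_add a)

theorem clamp_mem_Icc (r : ℝ) : clamp r ∈ Set.Icc (0 : ℝ) 1 :=
  ⟨le_max_left _ _, max_le zero_le_one (min_le_right _ _)⟩

theorem abs_clamp_sub_le {a : ℝ} (ha : a ∈ Set.Icc (0 : ℝ) 1) (z : ℝ) :
    |clamp (a + z) - a| ≤ |z| := by
  obtain ⟨h0, h1⟩ := ha
  unfold clamp
  rcases le_total 0 z with hz | hz
  · rw [abs_of_nonneg hz, abs_le]
    have h3 : a ≤ min (a + z) 1 := le_min (by linarith) h1
    have h4 := min_le_left (a + z) 1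
    rw [max_eq_right (h0.trans h3)]
    constructor <;> linarith
  · rw [abs_of_nonpos hz, min_eq_left (by linarith), abs_le]
    have h3 : a + z ≤ max 0 (a + z) := le_max_right _ _
    have h4 : max 0 (a + z) ≤ a := max_le h0 (by linarith)
    constructor <;> linarith

theorem evalOn_mem_Icc {X : Type*} {m : ℕ} (q : StatQuery X) (y : Fin m → X) :
    evalOn q y ∈ Set.Icc (0 : ℝ) 1 := by
  refine ⟨div_nonneg (Finset.sum_nonneg fun i _ => (q (y i)).2.1) (Nat.cast_nonneg m), ?_⟩
  refine div_le_one_of_le₀ ?_ (Nat.cast_nonneg m)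
  calc ∑ i, (q (y i) : ℝ) ≤ ∑ _i : Fin m, (1 : ℝ) := Finset.sum_le_sum fun i _ => (q (y i)).2.2
    _ = m := by simp

theorem clippedGaussianKernel_apply {X : Type*} (s : ℝ) {m : ℕ} (y : Fin m → X)
    (q : StatQuery X) : clippedGaussianKernel s y q
      = (gaussianReal 0 (s ^ 2).toNNReal).map fun z => clamp (evalOn q y + z) := by
  rw [clippedGaussianKernel, Kernel.map_apply _ (measurable_clippedGaussian y), Kernel.prod_apply,
    Kernel.id_apply, Kernel.const_apply, Measure.dirac_prod,
    Measure.map_map (measurable_clippedGaussian y) measurable_prodMk_left]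
  rfl

/-- Clamping is post-processing of a Gaussian centred at the empirical mean. -/
theorem holderDom_clippedGaussianKernel {X : Type*} {s : ℝ} (hs : s ≠ 0) {m m' : ℕ}
    (y : Fin m → X) (y' : Fin m' → X) (q : StatQuery X) {γ r : ℝ} (hγ : γ.HolderConjugate r) :
    HolderDom r
      (ENNReal.ofReal (Real.exp ((γ - 1) * ((evalOn q y - evalOn q y') ^ 2 / (2 * s ^ 2)))))
      (clippedGaussianKernel s y q) (clippedGaussianKernel s y' q) := by
  have key : ∀ {k : ℕ} (u : Fin k → X), clippedGaussianKernel s u q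
      = (gaussianReal (evalOn q u) (s ^ 2).toNNReal).map clamp := by
    intro k u
    rw [clippedGaussianKernel_apply]
    conv_rhs => rw [← zero_add (evalOn q u), ← gaussianReal_map_const_add]
    rw [Measure.map_map measurable_clamp (by fun_prop)]
    rfl
  rw [key, key]
  have hv : (s ^ 2).toNNReal ≠ 0 := by
    rw [Ne, Real.toNNReal_eq_zero, not_le]
    positivity
  have := holderDom_gaussianReal hγ (evalOn q y) (evalOn q y') hv
  rw [Real.coe_toNNReal _ (sq_nonneg s)] at this
  exact this.map measurable_clamp

/-- A clipped Gaussian answer always lies in `[0, 1]`. -/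
theorem clippedGaussianKernel_compl_Icc {X : Type*} (s : ℝ) {m : ℕ} (y : Fin m → X)
    (q : StatQuery X) : clippedGaussianKernel s y q (Set.Icc 0 1)ᶜ = 0 := by
  rw [clippedGaussianKernel_apply, Measure.map_apply
    (measurable_clamp_add _) measurableSet_Icc.compl]
  refine measure_mono_null (fun z hz => ?_) measure_empty
  exact hz (clamp_mem_Icc (evalOn q y + z))

/-! ### The complementary error function -/

theorem integrable_exp_neg_sq : Integrable fun t : ℝ => Real.exp (-t ^ 2) := by
  simpa using integrable_exp_neg_mul_sq one_pos

theorem erfc_eq_sub (x y : ℝ) :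
    erfc x = erfc y - 2 / √Real.pi * ∫ t in y..x, Real.exp (-t ^ 2) := by
  have h := intervalIntegral.integral_Ioi_sub_Ioi' (a := y) (b := x)
    integrable_exp_neg_sq.integrableOn integrable_exp_neg_sq.integrableOn (μ := volume)
  rw [erfc, erfc, ← h]
  ring

theorem strictAnti_erfc : StrictAnti erfc := by
  intro y x hxy
  rw [erfc_eq_sub x y]
  have : 0 < ∫ t in y..x, Real.exp (-t ^ 2) :=
    intervalIntegral.intervalIntegral_pos_of_pos integrable_exp_neg_sq.intervalIntegrable
      (fun t => Real.exp_pos _) hxy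
  have hpi := Real.pi_pos
  have : 0 < 2 / √Real.pi * ∫ t in y..x, Real.exp (-t ^ 2) := by positivity
  linarith

theorem continuous_erfc : Continuous erfc := by
  have : erfc = fun x => erfc 0 - 2 / √Real.pi * ∫ t in (0 : ℝ)..x, Real.exp (-t ^ 2) :=
    funext fun x => erfc_eq_sub x 0
  rw [this]
  exact continuous_const.sub (continuous_const.mul
    (intervalIntegral.continuous_primitive (fun a b => integrable_exp_neg_sq.intervalIntegrable) 0))

theorem erfc_zero : erfc 0 = 1 := by
  have h := integral_gaussian_Ioi 1
  simp only [neg_one_mul, div_one] at h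
  rw [erfc, h]
  have : √Real.pi ≠ 0 := (Real.sqrt_pos.2 Real.pi_pos).ne'
  field_simp

theorem tendsto_erfc_atTop : Filter.Tendsto erfc Filter.atTop (nhds 0) := by
  have h := intervalIntegral_tendsto_integral_Ioi (μ := volume) 0
    integrable_exp_neg_sq.integrableOn Filter.tendsto_id
  have h2 : Filter.Tendsto
      (fun x => erfc 0 - 2 / √Real.pi * ∫ t in (0 : ℝ)..x, Real.exp (-t ^ 2))
      Filter.atTop (nhds (erfc 0 - erfc 0)) := (h.const_mul (2 / √Real.pi)).const_sub _
  rw [sub_self] at h2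
  exact h2.congr fun x => (erfc_eq_sub x 0).symm

theorem erfc_pos (x : ℝ) : 0 < erfc x :=
  lt_of_le_of_lt (le_of_tendsto tendsto_erfc_atTop
    ((Filter.eventually_ge_atTop (x + 1)).mono fun _ h => strictAnti_erfc.antitone h))
    (strictAnti_erfc (lt_add_one x))

theorem erfcInv_erfc (x : ℝ) : erfcInv (erfc x) = x :=
  Function.leftInverse_invFun strictAnti_erfc.injective x

theorem erfc_erfcInv {y : ℝ} (hy : y ∈ Set.Ioo (0 : ℝ) 1) : erfc (erfcInv y) = y := by
  obtain ⟨x, hx⟩ : ∃ x, erfc x = y := by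
    obtain ⟨b, hb⟩ := (tendsto_erfc_atTop.eventually (gt_mem_nhds hy.1)).exists
    exact mem_range_of_exists_le_of_exists_ge continuous_erfc ⟨b, hb.le⟩
      ⟨0, by rw [erfc_zero]; exact hy.2.le⟩
  rw [← hx, erfcInv_erfc]

theorem erfcInv_pos {y : ℝ} (hy : y ∈ Set.Ioo (0 : ℝ) 1) : 0 < erfcInv y := by
  rw [← strictAnti_erfc.lt_iff_gt, erfc_erfcInv hy, erfc_zero]
  exact hy.2

/-- Since `erfc` is strictly decreasing, a one-sided bound on `erfcInv z` is a one-sided bound on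
`z`, which is an open condition. -/
theorem continuousAt_erfcInv {y : ℝ} (hy : y ∈ Set.Ioo (0 : ℝ) 1) : ContinuousAt erfcInv y := by
  have hev : ∀ᶠ z in nhds y, z ∈ Set.Ioo (0 : ℝ) 1 := isOpen_Ioo.mem_nhds hy
  refine tendsto_order.2 ⟨fun a ha => ?_, fun a ha => ?_⟩
  · rw [← strictAnti_erfc.lt_iff_gt, erfc_erfcInv hy] at ha
    filter_upwards [hev, gt_mem_nhds ha] with z hz hza
    rwa [← strictAnti_erfc.lt_iff_gt, erfc_erfcInv hz]
  · rw [gt_iff_lt, ← strictAnti_erfc.lt_iff_gt, erfc_erfcInv hy] at ha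
    filter_upwards [hev, lt_mem_nhds ha] with z hz hza
    rwa [← strictAnti_erfc.lt_iff_gt, erfc_erfcInv hz]

/-- The two-sided tail of a centred Gaussian. -/
theorem gaussianReal_abs_gt {σ : ℝ} (hσ : 0 < σ) {u : ℝ} (hu : 0 ≤ u) :
    gaussianReal 0 (σ ^ 2).toNNReal {z | √2 * σ * u < |z|} = ENNReal.ofReal (erfc u) := by
  have hv : (σ ^ 2).toNNReal ≠ 0 := by
    rw [Ne, Real.toNNReal_eq_zero, not_le]
    positivity
  set a := √2 * σ * u with ha
  have ha0 : 0 ≤ a := by positivity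
  have hset : {z : ℝ | a < |z|} = Set.Ioi a ∪ Set.Iio (-a) := by
    ext z
    simp only [Set.mem_ofPred_eq, lt_abs, Set.mem_union, Set.mem_Ioi, Set.mem_Iio, lt_neg]
  have hneg : gaussianReal 0 (σ ^ 2).toNNReal (Set.Iio (-a))
      = gaussianReal 0 (σ ^ 2).toNNReal (Set.Ioi a) := by
    conv_lhs => rw [← neg_zero (G := ℝ), ← gaussianReal_map_neg]
    rw [Measure.map_apply measurable_neg measurableSet_Iio]
    congr 1
    ext z
    simp
  have htail : gaussianReal 0 (σ ^ 2).toNNReal (Set.Ioi a) = ENNReal.ofReal (erfc u / 2) := by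
    rw [gaussianReal_apply_eq_integral _ hv]
    congr 1
    have hb : 0 < √2 * σ := by positivity
    -- The substitution `z = √2 σ t` turns the Gaussian density into a multiple of `exp (-t ^ 2)`.
    have h := integral_comp_mul_left_Ioi (gaussianPDFReal 0 (σ ^ 2).toNNReal) u hb
    rw [← ha, smul_eq_mul, eq_inv_mul_iff_mul_eq₀ hb.ne'] at h
    rw [← h, erfc]
    have hpdf : ∀ t : ℝ, gaussianPDFReal 0 (σ ^ 2).toNNReal (√2 * σ * t)
        = (√(2 * Real.pi * σ ^ 2))⁻¹ * Real.exp (-t ^ 2) := by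
      intro t
      rw [gaussianPDFReal, Real.coe_toNNReal _ (sq_nonneg σ)]
      congr 2
      have : (√2) ^ 2 = 2 := Real.sq_sqrt (by norm_num)
      rw [sub_zero, mul_pow, mul_pow, this]
      field_simp
    simp_rw [hpdf]
    rw [integral_const_mul, Real.sqrt_mul (by positivity), Real.sqrt_mul (by positivity),
      Real.sqrt_sq hσ.le]
    have h1 : √Real.pi ≠ 0 := (Real.sqrt_pos.2 Real.pi_pos).ne'
    have h2 : √(2 : ℝ) ≠ 0 := by positivity
    field_simp
  rw [hset, measure_union _ measurableSet_Iio, hneg, htail, ← ENNReal.ofReal_add]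
  · congr 1
    ring
  · exact (half_pos (erfc_pos u)).le
  · exact (half_pos (erfc_pos u)).le
  · rw [Set.disjoint_left]
    intro z hz hz'
    simp only [Set.mem_Ioi, Set.mem_Iio] at hz hz'
    linarith

/-- The threshold is exceeded by the noise with probability exactly `b`, and clamping never
increases the distance to a point of `[0, 1]`. -/
theorem clippedGaussianKernel_abs_sub_gt_le {X : Type*} {σ : ℝ} (hσ : 0 < σ) {m : ℕ}
    (y : Fin m → X) (q : StatQuery X) {b : ℝ} (hb : b ∈ Set.Ioo (0 : ℝ) 1) :
    clippedGaussianKernel σ y q {r | √2 * σ * erfcInv b < |r - evalOn q y|}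
      ≤ ENNReal.ofReal b := by
  rw [clippedGaussianKernel_apply, Measure.map_apply
    (measurable_clamp_add _)
    (measurableSet_lt measurable_const (by fun_prop))]
  calc _ ≤ gaussianReal 0 (σ ^ 2).toNNReal {z | √2 * σ * erfcInv b < |z|} :=
        measure_mono fun z hz => lt_of_lt_of_le hz (abs_clamp_sub_le (evalOn_mem_Icc q y) z)
    _ = _ := by rw [gaussianReal_abs_gt hσ (erfcInv_pos hb).le, erfc_erfcInv hb]

/-! ### The rounds of the queries -/

theorem totalQueries_mono (n₀ : ℕ) (kk : ℕ → ℕ) : Monotone fun t => totalQueries n₀ t kk :=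
  fun _ _ h => Finset.sum_le_sum_of_subset (Finset.Icc_subset_Icc_right h)

theorem roundOf_eq {n₀ : ℕ} {kk : ℕ → ℕ} {i t : ℕ} (h : i < totalQueries n₀ t kk)
    (h' : ∀ s < t, totalQueries n₀ s kk ≤ i) : roundOf n₀ kk i = t := by
  have hmem : t ∈ {t | i < ∑ τ ∈ Finset.Icc n₀ t, kk τ} := h
  refine le_antisymm (Nat.sInf_le hmem) ?_
  by_contra! hlt
  have := Nat.sInf_mem ⟨t, hmem⟩
  exact absurd (h' _ hlt) (not_le.2 this)

theorem roundOf_mem_Icc {n₀ n : ℕ} {kk : ℕ → ℕ} {i : ℕ} (h : i < totalQueries n₀ n kk) :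
    roundOf n₀ kk i ∈ Finset.Icc n₀ n := by
  have hmem : n ∈ {t | i < ∑ τ ∈ Finset.Icc n₀ t, kk τ} := h
  refine Finset.mem_Icc.2 ⟨?_, Nat.sInf_le hmem⟩
  have hs := Nat.sInf_mem ⟨n, hmem⟩
  by_contra! hlt
  change i < ∑ τ ∈ Finset.Icc n₀ (roundOf n₀ kk i), kk τ at hs
  rw [Finset.Icc_eq_empty (by omega)] at hs
  simp at hs

theorem sum_roundOf {n₀ n : ℕ} (hn : n₀ ≤ n) (kk : ℕ → ℕ) (g : ℕ → ℝ) :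
    ∑ i ∈ Finset.range (totalQueries n₀ n kk), g (roundOf n₀ kk i)
      = ∑ τ ∈ Finset.Icc n₀ n, kk τ * g τ := by
  induction n, hn using Nat.le_induction with
  | base =>
    have : ∀ i ∈ Finset.range (totalQueries n₀ n₀ kk), g (roundOf n₀ kk i) = g n₀ := by
      intro i hi
      have := roundOf_mem_Icc (Finset.mem_range.1 hi)
      rw [Finset.Icc_self, Finset.mem_singleton] at this
      rw [this]
    rw [Finset.sum_congr rfl this]
    simp [totalQueries]
  | succ n hn ih =>
    have htot : totalQueries n₀ (n + 1) kk = totalQueries n₀ n kk + kk (n + 1) :=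
      Finset.sum_Icc_succ_top (by omega) _
    rw [htot, Finset.sum_range_add, ih, Finset.sum_Icc_succ_top (by omega)]
    congr 1
    have : ∀ i ∈ Finset.range (kk (n + 1)),
        g (roundOf n₀ kk (totalQueries n₀ n kk + i)) = g (n + 1) := by
      intro i hi
      rw [Finset.mem_range] at hi
      rw [roundOf_eq (i := totalQueries n₀ n kk + i) (t := n + 1) (by omega) fun s hs =>
        (totalQueries_mono n₀ kk (Nat.lt_succ_iff.1 hs)).trans (Nat.le_add_right _ _)]
    rw [Finset.sum_congr rfl this]
    simp

/-! ### Sensitivity of statistical queries -/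

/-- As a sum over all `n` data points, the snapshot mean can be compared termwise when a single
point is exchanged. -/
theorem evalOn_snapshot {X : Type*} {n t : ℕ} (ht : t ≤ n) (q : StatQuery X) (x : Fin n → X) :
    evalOn q (snapshot x t) = ∑ j : Fin n, if (j : ℕ) < t then (q (x j) : ℝ) / t else 0 := by
  have hmin : min t n = t := min_eq_left ht
  let F : ℕ → ℝ := fun i => if h : i < n then (q (x ⟨i, h⟩) : ℝ) else 0
  have h1 : ∑ i, (q (snapshot x t i) : ℝ) = ∑ i ∈ Finset.range t, F i := by
    rw [← Fin.sum_univ_eq_sum_range, ← (finCongr hmin).sum_comp]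
    refine Finset.sum_congr rfl fun i _ => ?_
    have : (i : ℕ) < n := lt_of_lt_of_le i.2 (min_le_right _ _)
    simp only [F, finCongr_apply, Fin.val_cast, this, dite_true]
    rfl
  have h2 : (∑ j : Fin n, if (j : ℕ) < t then (q (x j) : ℝ) / t else 0)
      = ∑ i ∈ Finset.range n, if i < t then F i / t else 0 := by
    rw [← Fin.sum_univ_eq_sum_range (fun i => if i < t then F i / t else 0)]
    exact Finset.sum_congr rfl fun j _ => by simp [F]
  rw [h2, ← Finset.sum_filter, evalOn, h1, Finset.sum_div, hmin]
  refine Finset.sum_congr ?_ fun _ _ => rfl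
  ext i
  simp only [Finset.mem_range, Finset.mem_filter]
  omega

/-- Only the summand of `j` changes, by at most `1 / t`. The index `j + 1` appears because `rho`
counts data points from `1` and `Fin n` from `0`. -/
theorem sq_evalOn_snapshot_sub_le {X : Type*} {n t : ℕ} (ht : t ≤ n) (q : StatQuery X)
    (x : Fin n → X) (j : Fin n) (z : X) :
    (evalOn q (snapshot x t) - evalOn q (snapshot (Function.update x j z) t)) ^ 2
      ≤ (if (j : ℕ) + 1 ≤ t then 1 else 0) / (t : ℝ) ^ 2 := by
  rw [evalOn_snapshot ht, evalOn_snapshot ht, ← Finset.sum_sub_distrib,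
    Finset.sum_eq_single j]
  · simp only [Function.update_self, Nat.add_one_le_iff]
    split_ifs with h
    · rw [← sub_div, div_pow]
      gcongr
      rw [sq_le_one_iff_abs_le_one, abs_le]
      have h1 := (q (x j)).2
      have h2 := (q z).2
      constructor <;> linarith [h1.1, h1.2, h2.1, h2.2]
    · simp
  · intro i _ hij
    simp [Function.update_of_ne hij]
  · simp

/-- The interaction with the clipped Gaussian mechanism is approximately differentially private,
with a parameter that depends on the data point. -/
theorem integral_interact_le {X : Type*} {n₀ n : ℕ} (hn : n₀ ≤ n) (kk : ℕ → ℕ)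
    {σ : ℝ} (hσ : 0 < σ) (A : Analyst X) (x : Fin n → X) (j : Fin n) (z : X) {γ : ℝ} (hγ : 1 < γ)
    (ε : ℝ) {f : (Fin (totalQueries n₀ n kk) → StatQuery X × ℝ) → ℝ} (hf : Measurable f)
    (hf01 : ∀ p, f p ∈ Set.Icc (0 : ℝ) 1) :
    ∫ p, f p ∂interact (clippedGaussian X fun _ => σ) A n₀ kk x (totalQueries n₀ n kk)
      ≤ Real.exp ε * ∫ p, f p ∂interact (clippedGaussian X fun _ => σ) A n₀ kk
          (Function.update x j z) (totalQueries n₀ n kk)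
        + psi γ (rho n₀ n kk (fun _ => σ) (j + 1)) ε := by
  have hconj := Real.HolderConjugate.conjExponent hγ
  refine HolderDom.integral_le ε hconj ?_ hf hf01
  -- The privacy cost, for this data point, of a single query in round `t`; summed over all queries
  -- it gives `rho`.
  set g : ℕ → ℝ := fun t => (if (j : ℕ) + 1 ≤ t then 1 else 0) / (2 * σ ^ 2 * (t : ℝ) ^ 2) with hg
  have hsum : (γ - 1) * rho n₀ n kk (fun _ => σ) (j + 1)
      = ∑ i ∈ Finset.range (totalQueries n₀ n kk), (γ - 1) * g (roundOf n₀ kk i) := by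
    rw [← Finset.mul_sum, sum_roundOf hn, rho]
    congr 1
    exact Finset.sum_congr rfl fun τ _ => by rw [hg, mul_div_assoc]
  rw [hsum]
  refine holderDom_interact _ A n₀ kk x _ hconj (fun i => (γ - 1) * g (roundOf n₀ kk i)) _
    fun i hi q => ?_
  refine (holderDom_clippedGaussianKernel hσ.ne' _ _ q hconj).mono ?_
  refine ENNReal.ofReal_le_ofReal (Real.exp_le_exp.2 ?_)
  refine mul_le_mul_of_nonneg_left ?_ (by linarith)
  have h := sq_evalOn_snapshot_sub_le (Finset.mem_Icc.1 (roundOf_mem_Icc hi)).2 q x j z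
  calc _ ≤ ((if (j : ℕ) + 1 ≤ roundOf n₀ kk i then 1 else 0) / (roundOf n₀ kk i : ℝ) ^ 2)
        / (2 * σ ^ 2) := by gcongr
    _ = _ := by rw [div_div, mul_comm]

theorem interact_inaccurate_le {X : Type*} {n₀ n : ℕ} (kk : ℕ → ℕ) {σ : ℝ} (hσ : 0 < σ)
    (A : Analyst X) (x : Fin n → X) (m : ℕ) {b : ℝ} (hb : b ∈ Set.Ioo (0 : ℝ) 1) :
    (interact (clippedGaussian X fun _ => σ) A n₀ kk x m).real {p | ∃ i : Fin m,
      √2 * σ * erfcInv b < |(p i).2 - evalOn (p i).1 (snapshot x (roundOf n₀ kk i))|}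
      ≤ m * b := by
  have h := interact_exists_le (clippedGaussian X fun _ => σ) A n₀ kk x
    (fun i => {z | √2 * σ * erfcInv b < |z.2 - evalOn z.1 (snapshot x (roundOf n₀ kk i))|})
    (fun i => measurableSet_lt measurable_const (by unfold evalOn; fun_prop))
    (ENNReal.ofReal b) m
    (fun i _ q => clippedGaussianKernel_abs_sub_gt_le hσ (snapshot x (roundOf n₀ kk i)) q hb)
  refine ENNReal.toReal_le_of_le_ofReal (mul_nonneg (Nat.cast_nonneg m) hb.1.le) ?_
  rwa [ENNReal.ofReal_mul (Nat.cast_nonneg m), ENNReal.ofReal_natCast]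

theorem ae_interact_mem_Icc {X : Type*} {n₀ n : ℕ} (kk : ℕ → ℕ) (σ : ℝ)
    (A : Analyst X) (x : Fin n → X) (m : ℕ) :
    ∀ᵐ p ∂interact (clippedGaussian X fun _ => σ) A n₀ kk x m,
      ∀ i : Fin m, (p i).2 ∈ Set.Icc (0 : ℝ) 1 := by
  have h := interact_exists_le (clippedGaussian X fun _ => σ) A n₀ kk x
    (fun _ => {z | z.2 ∈ (Set.Icc (0 : ℝ) 1)ᶜ})
    (fun i => measurable_snd measurableSet_Icc.compl) 0 m
    (fun i _ q => (clippedGaussianKernel_compl_Icc σ _ q).le)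
  rw [mul_zero, nonpos_iff_eq_zero] at h
  rw [ae_iff]
  convert h using 2
  ext p
  simp

/-! ### Measurable selection from finitely many sets -/

/-- Induction over the index set: each new set takes precedence over the earlier choice. Where no
set contains `ω`, the value is arbitrary. -/
theorem exists_measurable_selector {Ω ι : Type*} [MeasurableSpace Ω] [MeasurableSpace ι]
    [Fintype ι] [Nonempty ι] (S : ι → Set Ω) (hS : ∀ i, MeasurableSet (S i)) :
    ∃ s : Ω → ι, Measurable s ∧ ∀ ω, (∃ i, ω ∈ S i) → ω ∈ S (s ω) := by
  classical
  suffices ∀ F : Finset ι, ∃ s : Ω → ι, Measurable s ∧ ∀ ω, (∃ i ∈ F, ω ∈ S i) → ω ∈ S (s ω) by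
    simpa using this Finset.univ
  intro F
  induction F using Finset.induction_on with
  | empty => exact ⟨fun _ => Classical.arbitrary ι, measurable_const, by simp⟩
  | insert a F _ ih =>
    obtain ⟨s, hs, h⟩ := ih
    refine ⟨fun ω => if ω ∈ S a then a else s ω, Measurable.ite (hS a) measurable_const hs, ?_⟩
    rintro ω ⟨i, hi, hiω⟩
    by_cases ha : ω ∈ S a
    · simp [ha]
    · simp only [ha, if_false]
      rcases Finset.mem_insert.1 hi with rfl | hi
      · exact absurd hiω ha
      · exact h ω ⟨i, hi, hiω⟩

theorem measurable_comp_selector {Ω ι β : Type*} [MeasurableSpace Ω] [MeasurableSpace ι]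
    [MeasurableSpace β] [Countable ι] [MeasurableSingletonClass ι] {s : Ω → ι}
    (hs : Measurable s) {f : ι → Ω → β} (hf : ∀ i, Measurable (f i)) :
    Measurable fun ω => f (s ω) ω :=
  (measurable_from_prod_countable_left (f := fun p : Ω × ι => f p.2 p.1) hf).comp
    (measurable_id.prodMk hs)

/-! ### Transfer of privacy to i.i.d. data -/

section Resample

variable {X : Type*} [Fintype X] {n : ℕ}

theorem sum_prod_eq_one {p : X → ℝ} (hp1 : ∑ y, p y = 1) : ∑ x : Fin n → X, ∏ i, p (x i) = 1 := by
  classical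
  rw [← Fintype.piFinset_univ, ← Finset.prod_univ_sum (fun _ => Finset.univ) (fun _ y => p y)]
  simp [hp1]

/-- Exchanging one data point for an independent copy. -/
theorem sum_resample_le {p : X → ℝ} (hp : ∀ y, 0 ≤ p y) (hp1 : ∑ y, p y = 1) (j : Fin n)
    (Φ : (Fin n → X) → X → ℝ) {a δ : ℝ}
    (h : ∀ x z y, Φ x y ≤ a * Φ (Function.update x j z) y + δ) :
    ∑ x : Fin n → X, (∏ i, p (x i)) * Φ x (x j)
      ≤ a * ∑ x : Fin n → X, (∏ i, p (x i)) * ∑ y, p y * Φ x y + δ := by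
  classical
  have hw : ∀ x : Fin n → X, 0 ≤ ∏ i, p (x i) := fun x => Finset.prod_nonneg fun i _ => hp _
  -- Swapping the `j`-th data point with the fresh copy is an involution that preserves the product
  -- weights.
  let e : (Fin n → X) × X → (Fin n → X) × X := fun u => (Function.update u.1 j u.2, u.1 j)
  have he : Function.Involutive e := by
    rintro ⟨x, y⟩
    simp [e]
  have hwe : ∀ u : (Fin n → X) × X,
      (∏ i, p (u.1 i)) * p u.2 = (∏ i, p ((e u).1 i)) * p (e u).2 := by
    rintro ⟨x, y⟩
    simp only [e]
    rw [← Finset.mul_prod_erase _ _ (Finset.mem_univ j),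
      ← Finset.mul_prod_erase _ (fun i => p (Function.update x j y i)) (Finset.mem_univ j),
      Function.update_self]
    have : ∏ i ∈ Finset.univ.erase j, p (Function.update x j y i)
        = ∏ i ∈ Finset.univ.erase j, p (x i) :=
      Finset.prod_congr rfl fun i hi => by
        rw [Function.update_of_ne (Finset.ne_of_mem_erase hi)]
    rw [this]
    ring
  have h1 : ∑ x : Fin n → X, (∏ i, p (x i)) * Φ x (x j)
      = ∑ u : (Fin n → X) × X, (∏ i, p (u.1 i)) * p u.2 * Φ u.1 (u.1 j) := by
    rw [Fintype.sum_prod_type]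
    refine Finset.sum_congr rfl fun x _ => ?_
    simp only
    rw [← Finset.sum_mul, ← Finset.mul_sum, hp1, mul_one]
  have h2 : ∑ u : (Fin n → X) × X, (∏ i, p (u.1 i)) * p u.2 * Φ (e u).1 (e u).2
      = ∑ x : Fin n → X, (∏ i, p (x i)) * ∑ y, p y * Φ x y := by
    rw [Finset.sum_congr rfl fun u _ => congrArg (· * Φ (e u).1 (e u).2) (hwe u),
      he.bijective.sum_comp fun u => (∏ i, p (u.1 i)) * p u.2 * Φ u.1 u.2,
      Fintype.sum_prod_type]
    refine Finset.sum_congr rfl fun x _ => ?_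
    rw [Finset.mul_sum]
    exact Finset.sum_congr rfl fun y _ => by ring
  have h3 : ∑ u : (Fin n → X) × X, (∏ i, p (u.1 i)) * p u.2 = 1 := by
    rw [Fintype.sum_prod_type]
    simp_rw [← Finset.mul_sum, hp1, mul_one]
    exact sum_prod_eq_one hp1
  calc _ = _ := h1
    _ ≤ ∑ u : (Fin n → X) × X,
        (∏ i, p (u.1 i)) * p u.2 * (a * Φ (e u).1 (e u).2 + δ) := by
        refine Finset.sum_le_sum fun u _ => ?_
        exact mul_le_mul_of_nonneg_left (h u.1 u.2 (u.1 j)) (mul_nonneg (hw _) (hp _))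
    _ = a * ∑ u : (Fin n → X) × X, (∏ i, p (u.1 i)) * p u.2 * Φ (e u).1 (e u).2
        + δ * ∑ u : (Fin n → X) × X, (∏ i, p (u.1 i)) * p u.2 := by
        rw [Finset.mul_sum, Finset.mul_sum, ← Finset.sum_add_distrib]
        exact Finset.sum_congr rfl fun u _ => by ring
    _ = _ := by rw [h2, h3, mul_one]

end Resample

theorem integrable_of_mem_Icc {Ω : Type*} [MeasurableSpace Ω] {μ : Measure Ω} [IsFiniteMeasure μ]
    {f : Ω → ℝ} (hf : Measurable f) {a b : ℝ} (h : ∀ ω, f ω ∈ Set.Icc a b) : Integrable f μ :=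
  Integrable.of_mem_Icc a b hf.aemeasurable (.of_forall h)

theorem sum_ite_lt_div {n t : ℕ} (ht : 1 ≤ t) (htn : t ≤ n) (c : ℝ) :
    (∑ j : Fin n, if (j : ℕ) < t then c / t else 0) = c := by
  have ht0 : (t : ℝ) ≠ 0 := by exact_mod_cast (by omega : t ≠ 0)
  rw [Fin.sum_univ_eq_sum_range (fun j => if j < t then c / t else 0) n, ← Finset.sum_filter]
  have : (Finset.range n).filter (· < t) = Finset.range t := by
    ext i
    simp only [Finset.mem_range, Finset.mem_filter]
    omega
  rw [this, Finset.sum_const, Finset.card_range, nsmul_eq_mul, mul_div_cancel₀ _ ht0]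

/-- A private output `g` of i.i.d. data, a `[0, 1]`-valued query, has nearly the same mean on the
data as on the population, on average over any event `B`. -/
theorem sum_integral_query_le {X : Type*} [Fintype X] {n : ℕ} {p : X → ℝ} (hp : ∀ y, 0 ≤ p y)
    (hp1 : ∑ y, p y = 1) {Ω : Type*} [MeasurableSpace Ω] (ν : (Fin n → X) → Measure Ω)
    [∀ x, IsProbabilityMeasure (ν x)] {ε : ℝ} (hε : 0 ≤ ε) {δ : Fin n → ℝ}
    (hν : ∀ x j z, ∀ f : Ω → ℝ, Measurable f → (∀ ω, f ω ∈ Set.Icc (0 : ℝ) 1) →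
      ∫ ω, f ω ∂ν x ≤ Real.exp ε * ∫ ω, f ω ∂ν (Function.update x j z) + δ j)
    {n₀ : ℕ} (hn₀ : 1 ≤ n₀) {t : Ω → ℕ} (ht : Measurable t) (htn : ∀ ω, t ω ∈ Finset.Icc n₀ n)
    {g : Ω → X → ℝ} (hg : ∀ y, Measurable fun ω => g ω y)
    (hg01 : ∀ ω y, g ω y ∈ Set.Icc (0 : ℝ) 1) {B : Set Ω} (hB : MeasurableSet B) :
    ∑ x : Fin n → X, (∏ i, p (x i)) * ∫ ω, B.indicator
        (fun ω => (∑ j : Fin n, if (j : ℕ) < t ω then g ω (x j) / t ω else 0)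
          - ∑ y, p y * g ω y) ω ∂ν x
      ≤ (Real.exp ε - 1) * ∑ x : Fin n → X, (∏ i, p (x i)) * (ν x).real B
        + (∑ j, δ j) / n₀ := by
  have hn₀' : (0 : ℝ) < n₀ := by exact_mod_cast hn₀
  have htpos : ∀ ω, (0 : ℝ) < t ω := fun ω => by
    have := (Finset.mem_Icc.1 (htn ω)).1
    exact_mod_cast (by omega : 0 < t ω)
  have hw : ∀ x : Fin n → X, 0 ≤ ∏ i, p (x i) := fun x => Finset.prod_nonneg fun i _ => hp _
  -- The share of data point `j`, with value `y`, in the empirical mean of the selected query,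
  -- restricted to `B`.
  set G : Fin n → X → Ω → ℝ := fun j y =>
    B.indicator fun ω => if (j : ℕ) < t ω then g ω y / t ω else 0 with hG
  have hGm : ∀ j y, Measurable (G j y) := fun j y =>
    Measurable.indicator (Measurable.ite (measurableSet_lt measurable_const ht)
      ((hg y).div (measurable_from_nat.comp ht)) measurable_const) hB
  have hG0 : ∀ j y ω, 0 ≤ G j y ω := by
    intro j y ω
    refine Set.indicator_nonneg (fun ω _ => ?_) ω
    split_ifs
    · exact div_nonneg (hg01 ω y).1 (htpos ω).le
    · exact le_rfl
  -- Snapshots have at least `n₀` points, so `n₀ * G` is an admissible test function for privacy;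
  -- this puts the `1 / n₀` in front of `∑ δ`.
  have hG1 : ∀ j y ω, n₀ * G j y ω ≤ 1 := by
    intro j y ω
    by_cases hω : ω ∈ B
    · simp only [hG, Set.indicator_of_mem hω]
      split_ifs
      · rw [← mul_div_assoc, div_le_one (htpos ω)]
        have : (n₀ : ℝ) ≤ t ω := by exact_mod_cast (Finset.mem_Icc.1 (htn ω)).1
        nlinarith [(hg01 ω y).1, (hg01 ω y).2]
      · simp
    · simp [hG, hω]
  have hGi : ∀ j y x, Integrable (G j y) (ν x) := by
    intro j y x
    refine integrable_of_mem_Icc (hGm j y) (a := 0) (b := 1 / n₀) fun ω => ⟨hG0 j y ω, ?_⟩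
    rw [le_div_iff₀ hn₀', mul_comm]
    exact hG1 j y ω
  set H : X → Ω → ℝ := fun y => B.indicator fun ω => g ω y with hH
  have hH01 : ∀ y ω, H y ω ∈ Set.Icc 0 (B.indicator (fun _ => (1 : ℝ)) ω) := by
    intro y ω
    by_cases hω : ω ∈ B
    · simpa [hH, hω] using hg01 ω y
    · simp [hH, hω]
  have hBi : ∀ x, Integrable (B.indicator fun _ => (1 : ℝ)) (ν x) := fun x =>
    (integrable_const _).indicator hB
  have hHi : ∀ y x, Integrable (H y) (ν x) := fun y x =>
    (hBi x).mono' ((hg y).indicator hB).aestronglyMeasurable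
      (.of_forall fun ω => by rw [Real.norm_of_nonneg (hH01 y ω).1]; exact (hH01 y ω).2)
  have hHB : ∀ y x, ∫ ω, H y ω ∂ν x ≤ (ν x).real B := by
    intro y x
    refine (integral_mono (hHi y x) (hBi x) fun ω => (hH01 y ω).2).trans_eq ?_
    rw [integral_indicator_const _ hB, smul_eq_mul, mul_one]
  have hGH : ∀ y ω, ∑ j, G j y ω = H y ω := by
    intro y ω
    by_cases hω : ω ∈ B
    · simp only [hG, hH, Set.indicator_of_mem hω]
      have ht' := Finset.mem_Icc.1 (htn ω)
      exact sum_ite_lt_div (hn₀.trans ht'.1) ht'.2 _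
    · simp [hG, hH, hω]
  have hsplit : ∀ x : Fin n → X, ∫ ω, B.indicator
        (fun ω => (∑ j : Fin n, if (j : ℕ) < t ω then g ω (x j) / t ω else 0)
          - ∑ y, p y * g ω y) ω ∂ν x
      = ∑ j, ∫ ω, G j (x j) ω ∂ν x - ∑ y, p y * ∫ ω, H y ω ∂ν x := by
    intro x
    have : ∀ ω, B.indicator
        (fun ω => (∑ j : Fin n, if (j : ℕ) < t ω then g ω (x j) / t ω else 0)
          - ∑ y, p y * g ω y) ω = ∑ j, G j (x j) ω - ∑ y, p y * H y ω := by
      intro ω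
      by_cases hω : ω ∈ B <;> simp [hG, hH, hω]
    simp_rw [this]
    rw [integral_sub (integrable_finsetSum _ fun j _ => hGi _ _ _)
      (integrable_finsetSum _ fun y _ => (hHi y x).const_mul _),
      integral_finsetSum _ fun j _ => hGi _ _ _,
      integral_finsetSum _ fun y _ => (hHi y x).const_mul _]
    simp_rw [integral_const_mul]
  have hres : ∀ j : Fin n, ∑ x : Fin n → X, (∏ i, p (x i)) * ∫ ω, G j (x j) ω ∂ν x
      ≤ Real.exp ε * ∑ x : Fin n → X, (∏ i, p (x i)) * ∑ y, p y * ∫ ω, G j y ω ∂ν x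
        + δ j / n₀ := by
    intro j
    refine sum_resample_le hp hp1 j (fun x y => ∫ ω, G j y ω ∂ν x) fun x z y => ?_
    have := hν x j z (fun ω => n₀ * G j y ω) ((hGm j y).const_mul _)
      fun ω => ⟨mul_nonneg hn₀'.le (hG0 j y ω), hG1 j y ω⟩
    simp_rw [integral_const_mul] at this
    rw [← mul_le_mul_iff_right₀ hn₀', mul_add, mul_div_cancel₀ _ hn₀'.ne']
    linarith
  -- The population mean of the selected query, integrated over `B`. Resampling bounds the empirical
  -- counterpart by `e^ε E + (∑ δ) / n₀`, and `E ≤ P(B)`.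
  set E := ∑ x : Fin n → X, (∏ i, p (x i)) * ∑ y, p y * ∫ ω, H y ω ∂ν x with hE
  have hEB : E ≤ ∑ x : Fin n → X, (∏ i, p (x i)) * (ν x).real B := by
    refine Finset.sum_le_sum fun x _ => mul_le_mul_of_nonneg_left ?_ (hw x)
    calc ∑ y, p y * ∫ ω, H y ω ∂ν x ≤ ∑ y, p y * (ν x).real B :=
          Finset.sum_le_sum fun y _ => mul_le_mul_of_nonneg_left (hHB y x) (hp y)
      _ = _ := by rw [← Finset.sum_mul, hp1, one_mul]
  have hsumE : ∑ j : Fin n, ∑ x : Fin n → X, (∏ i, p (x i)) * ∑ y, p y * ∫ ω, G j y ω ∂ν x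
      = E := by
    rw [Finset.sum_comm]
    refine Finset.sum_congr rfl fun x _ => ?_
    rw [← Finset.mul_sum, Finset.sum_comm]
    congr 1
    refine Finset.sum_congr rfl fun y _ => ?_
    rw [← Finset.mul_sum, ← integral_finsetSum _ fun j _ => hGi j y x]
    simp_rw [hGH]
  have htot := Finset.sum_le_sum fun j (_ : j ∈ Finset.univ) => hres j
  rw [Finset.sum_comm, Finset.sum_add_distrib, ← Finset.mul_sum, hsumE, ← Finset.sum_div] at htot
  simp_rw [← Finset.mul_sum] at htot
  simp_rw [hsplit, mul_sub, Finset.sum_sub_distrib]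
  rw [← hE]
  have h1 : (Real.exp ε - 1) * E
      ≤ (Real.exp ε - 1) * ∑ x : Fin n → X, (∏ i, p (x i)) * (ν x).real B :=
    mul_le_mul_of_nonneg_left hEB (by linarith [Real.one_le_exp hε])
  linarith

/-! ### Distributional accuracy -/

section Accuracy

variable {X : Type*} [Finite X] [MeasurableSpace X] [MeasurableSingletonClass X]

theorem popValue_mem_Icc (q : StatQuery X) (P : Measure X) [IsProbabilityMeasure P] (t : ℕ) :
    popValue q P t ∈ Set.Icc (0 : ℝ) 1 := by
  have hintegr : Integrable (fun y => evalOn q y) (Measure.pi fun _ : Fin t => P) :=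
    Integrable.of_finite
  refine ⟨integral_nonneg fun y => (evalOn_mem_Icc q y).1, ?_⟩
  refine (integral_mono hintegr (integrable_const (1 : ℝ))
    fun y => (evalOn_mem_Icc q y).2).trans_eq ?_
  simp

theorem popValue_eq_sum [Fintype X] (q : StatQuery X) (P : Measure X) [IsProbabilityMeasure P]
    {t : ℕ} (ht : 1 ≤ t) : popValue q P t = ∑ y, P.real {y} * q y := by
  have ht' : (t : ℝ) ≠ 0 := by exact_mod_cast (by omega : t ≠ 0)
  unfold popValue evalOn
  rw [integral_div, integral_finsetSum _ fun i _ => Integrable.of_finite]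
  have : ∀ i : Fin t, ∫ y, (q (y i) : ℝ) ∂(Measure.pi fun _ : Fin t => P)
      = ∑ y, P.real {y} * q y := by
    intro i
    rw [integral_comp_eval (μ := fun _ : Fin t => P) (f := fun y : X => (q y : ℝ))
      (measurable_of_finite _).aestronglyMeasurable, integral_fintype Integrable.of_finite]
    rfl
  simp only [this, Finset.sum_const, Finset.card_univ, Fintype.card_fin, nsmul_eq_mul]
  field_simp

theorem measureReal_jointLaw_snd [Fintype X] (M : Mechanism X) (A : Analyst X) (n₀ n : ℕ)
    (kk : ℕ → ℕ) (P : Measure X) [IsProbabilityMeasure P]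
    {S : Set (Fin (totalQueries n₀ n kk) → StatQuery X × ℝ)} (hS : MeasurableSet S) :
    (jointLaw M A n₀ n kk P).real (Prod.snd ⁻¹' S)
      = ∑ x : Fin n → X, (∏ i, P.real {x i})
        * (interact M A n₀ kk x (totalQueries n₀ n kk)).real S := by
  classical
  have : IsMarkovKernel (Kernel.ofFunOfCountable fun x : Fin n → X =>
      interact M A n₀ kk x (totalQueries n₀ n kk)) :=
    ⟨fun x => isProbabilityMeasure_interact M A n₀ kk x _⟩
  rw [Measure.real, jointLaw, Measure.compProd_apply (measurable_snd hS), lintegral_fintype,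
    ENNReal.toReal_sum fun x _ => by finiteness]
  refine Finset.sum_congr rfl fun x _ => ?_
  rw [ENNReal.toReal_mul, mul_comm, Measure.pi_singleton, ENNReal.toReal_prod]
  rfl

theorem measurable_error (n₀ : ℕ) (hn₀ : 1 ≤ n₀) (n : ℕ) (kk : ℕ → ℕ) (P : Measure X)
    [IsProbabilityMeasure P] (i : Fin (totalQueries n₀ n kk)) :
    Measurable fun p : Fin (totalQueries n₀ n kk) → StatQuery X × ℝ =>
      (p i).2 - popValue (p i).1 P (roundOf n₀ kk i) := by
  have := Fintype.ofFinite X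
  have ht : 1 ≤ roundOf n₀ kk i := hn₀.trans (Finset.mem_Icc.1 (roundOf_mem_Icc i.2)).1
  simp_rw [popValue_eq_sum _ P ht]
  fun_prop

/-- Accuracy follows from a bound on the probability of the inaccurate transcripts. -/
theorem distAccurate_of_le [Fintype X] {M : Mechanism X} {n₀ n : ℕ} (hn₀ : 1 ≤ n₀) {kk : ℕ → ℕ}
    {a b : ℝ}
    (h : ∀ (A : Analyst X) (P : Measure X), IsProbabilityMeasure P →
      ∑ x : Fin n → X, (∏ i, P.real {x i})
        * (interact M A n₀ kk x (totalQueries n₀ n kk)).real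
          {p | ∃ i, a < |(p i).2 - popValue (p i).1 P (roundOf n₀ kk i)|} ≤ b) :
    DistAccurate M n₀ n kk (fun _ => a) b := by
  intro A P hP
  have hmeas : MeasurableSet {p : Fin (totalQueries n₀ n kk) → StatQuery X × ℝ |
      ∃ i, a < |(p i).2 - popValue (p i).1 P (roundOf n₀ kk i)|} := by
    rw [Set.ofPred_exists]
    exact MeasurableSet.iUnion fun i => measurableSet_lt measurable_const
      (measurable_error n₀ hn₀ n kk P i).abs
  have hset : {p : (Fin n → X) × (Fin (totalQueries n₀ n kk) → StatQuery X × ℝ) |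
      ∀ t ∈ Finset.Icc n₀ n, ∀ i : Fin (totalQueries n₀ n kk), roundOf n₀ kk i = t →
        |(p.2 i).2 - popValue (p.2 i).1 P t| ≤ a}
      = Prod.snd ⁻¹' {p : Fin (totalQueries n₀ n kk) → StatQuery X × ℝ |
        ∃ i, a < |(p i).2 - popValue (p i).1 P (roundOf n₀ kk i)|}ᶜ := by
    ext p
    simp only [Set.mem_ofPred_eq, Set.mem_preimage, Set.mem_compl_iff, not_exists, not_lt]
    exact ⟨fun hp i => hp _ (roundOf_mem_Icc i.2) i rfl, fun hp t _ i hi => hi ▸ hp i⟩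
  rw [hset, measureReal_jointLaw_snd M A n₀ n kk P hmeas.compl]
  simp_rw [probReal_compl_eq_one_sub hmeas, mul_sub, mul_one, Finset.sum_sub_distrib]
  have hp1 : ∑ y, P.real {y} = 1 := by
    rw [sum_measureReal_singleton]
    simp
  rw [sum_prod_eq_one hp1]
  linarith [h A P hP]

/-- Responses in `[0, 1]` have an error of at most `1`. -/
theorem distAccurate_of_one_le {n₀ n : ℕ} (hn₀ : 1 ≤ n₀) (kk : ℕ → ℕ) (σ : ℝ) {a b : ℝ}
    (ha : 1 ≤ a) (hb : 0 ≤ b) :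
    DistAccurate (clippedGaussian X fun _ => σ) n₀ n kk (fun _ => a) b := by
  have := Fintype.ofFinite X
  refine distAccurate_of_le hn₀ fun A P hP => ?_
  rw [Finset.sum_eq_zero fun x _ => ?_]
  · exact hb
  rw [mul_eq_zero]
  right
  rw [measureReal_eq_zero_iff]
  refine measure_mono_null ?_ (ae_iff.1 (ae_interact_mem_Icc kk σ A x _))
  rintro p ⟨i, hi⟩ hp
  have h1 := hp i
  have h2 := popValue_mem_Icc (p i).1 P (roundOf n₀ kk i)
  have : |(p i).2 - popValue (p i).1 P (roundOf n₀ kk i)| ≤ 1 :=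
    abs_le.2 ⟨by linarith [h1.1, h2.2], by linarith [h1.2, h2.1]⟩
  linarith

/-- The order `γ` is free here. The hypothesis `hpos` makes the coefficient of `P(B)` in the final
inequality positive, so that it can be cancelled. -/
theorem distAccurate_clippedGaussian {n₀ n : ℕ} (hn₀ : 1 ≤ n₀) (hn : n₀ ≤ n) (kk : ℕ → ℕ)
    (hk : 1 ≤ totalQueries n₀ n kk) {σ β ε γ a b : ℝ} (hσ : 0 < σ) (hβ : β ∈ Set.Ioo (0 : ℝ) 1)
    (hε : 0 ≤ ε) (hγ : 1 < γ)
    (hpos : 0 < β + (∑ j : Fin n, psi γ (rho n₀ n kk (fun _ => σ) (j + 1)) ε) / n₀)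
    (h : β + (∑ j : Fin n, psi γ (rho n₀ n kk (fun _ => σ) (j + 1)) ε) / n₀
      ≤ b * (a - √2 * σ * erfcInv (β / totalQueries n₀ n kk) - (Real.exp ε - 1))) (hb : 0 < b) :
    DistAccurate (clippedGaussian X fun _ => σ) n₀ n kk (fun _ => a) b := by
  have := Fintype.ofFinite X
  have hk' : (1 : ℝ) ≤ totalQueries n₀ n kk := by exact_mod_cast hk
  have hbk : β / totalQueries n₀ n kk ∈ Set.Ioo (0 : ℝ) 1 :=
    ⟨div_pos hβ.1 (by linarith), (div_lt_one (by linarith)).2 (by linarith [hβ.2])⟩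
  set α := √2 * σ * erfcInv (β / totalQueries n₀ n kk)
  have hα0 : 0 < α := mul_pos (by positivity) (erfcInv_pos hbk)
  refine distAccurate_of_le hn₀ fun A P hP => ?_
  set k := totalQueries n₀ n kk
  have : Nonempty (Fin k) := ⟨⟨0, hk⟩⟩
  set ν : (Fin n → X) → Measure (Fin k → StatQuery X × ℝ) := fun x =>
    interact (clippedGaussian X fun _ => σ) A n₀ kk x k
  have hround : ∀ i : Fin k, roundOf n₀ kk i ∈ Finset.Icc n₀ n := fun i => roundOf_mem_Icc i.2
  have hround1 : ∀ i : Fin k, 1 ≤ roundOf n₀ kk i := fun i =>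
    hn₀.trans (Finset.mem_Icc.1 (hround i)).1
  let p : X → ℝ := fun y => P.real {y}
  have hp1 : ∑ y, p y = 1 := by
    simp only [p]
    rw [sum_measureReal_singleton]
    simp
  have hdiff := measurable_error n₀ hn₀ n kk P
  -- The Boolean records the sign of the error.
  let S : Fin k × Bool → Set (Fin k → StatQuery X × ℝ) := fun l =>
    {π | a < (if l.2 then 1 else -1) * ((π l.1).2 - popValue (π l.1).1 P (roundOf n₀ kk l.1))}
  have hS : ∀ l, MeasurableSet (S l) := fun l =>
    measurableSet_lt measurable_const ((hdiff l.1).const_mul _)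
  obtain ⟨s, hs, hsS⟩ := exists_measurable_selector S hS
  set B : Set (Fin k → StatQuery X × ℝ) :=
    {π | ∃ i, a < |(π i).2 - popValue (π i).1 P (roundOf n₀ kk i)|} with hB
  have hBm : MeasurableSet B := by
    rw [hB, Set.ofPred_exists]
    exact MeasurableSet.iUnion fun i => measurableSet_lt measurable_const (hdiff i).abs
  have hBS : ∀ π ∈ B, π ∈ S (s π) := by
    rintro π ⟨i, hi⟩
    refine hsS π ?_
    rcases lt_abs.1 hi with hi | hi
    · exact ⟨(i, true), by simpa [S] using hi⟩
    · exact ⟨(i, false), by simpa [S] using hi⟩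
  let t : (Fin k → StatQuery X × ℝ) → ℕ := fun π => roundOf n₀ kk (s π).1
  have ht : Measurable t := (measurable_of_countable fun l : Fin k × Bool =>
    roundOf n₀ kk l.1).comp hs
  -- For a negative error the query is replaced by its complement `1 - q`, so that every selected
  -- error is positive and `g` stays in `[0, 1]`.
  let g : (Fin k → StatQuery X × ℝ) → X → ℝ := fun π y =>
    if (s π).2 then ((π (s π).1).1 y : ℝ) else 1 - (π (s π).1).1 y
  have hg : ∀ y, Measurable fun π => g π y := fun y =>
    measurable_comp_selector hs
      (f := fun l π => if l.2 then ((π l.1).1 y : ℝ) else 1 - (π l.1).1 y) fun l => by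
        split_ifs <;> fun_prop
  have hg01 : ∀ π y, g π y ∈ Set.Icc (0 : ℝ) 1 := by
    intro π y
    have := ((π (s π).1).1 y).2
    simp only [g]
    split_ifs
    · exact this
    · exact ⟨by linarith [this.2], by linarith [this.1]⟩
  have hgen := sum_integral_query_le (p := p) (fun y => measureReal_nonneg) hp1 ν hε
    (δ := fun j => psi γ (rho n₀ n kk (fun _ => σ) (j + 1)) ε)
    (fun x j z f hf hf01 => integral_interact_le hn kk hσ A x j z hγ ε hf hf01) hn₀ ht
    (fun π => hround _) hg hg01 hBm
  let I : (Fin n → X) → Set (Fin k → StatQuery X × ℝ) := fun x => {π | ∃ i : Fin k,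
    α < |(π i).2 - evalOn (π i).1 (snapshot x (roundOf n₀ kk i))|}
  have hIm : ∀ x, MeasurableSet (I x) := fun x => by
    simp only [I]
    rw [Set.ofPred_exists]
    exact MeasurableSet.iUnion fun i => measurableSet_lt measurable_const
      (by unfold evalOn; fun_prop)
  have hI : ∀ x, (ν x).real (I x) ≤ β := by
    intro x
    refine (interact_inaccurate_le kk hσ A x k hbk).trans_eq ?_
    field_simp
  let D : (Fin n → X) → (Fin k → StatQuery X × ℝ) → ℝ := fun x π =>
    (∑ j : Fin n, if (j : ℕ) < t π then g π (x j) / t π else 0) - ∑ y, p y * g π y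
  have hD : ∀ x π, D x π = (if (s π).2 then 1 else -1)
      * (evalOn (π (s π).1).1 (snapshot x (t π)) - popValue (π (s π).1).1 P (t π)) := by
    intro x π
    have ht1 : 1 ≤ t π := hround1 _
    have htn : t π ≤ n := (Finset.mem_Icc.1 (hround (s π).1)).2
    simp only [D, g]
    rw [popValue_eq_sum _ P ht1, evalOn_snapshot htn]
    split_ifs with hsgn
    · rw [one_mul]
    · have e1 := sum_ite_lt_div ht1 htn 1
      have e2 : (∑ j : Fin n, if (j : ℕ) < t π
            then (1 - ((π (s π).1).1 (x j) : ℝ)) / t π else 0)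
          = 1 - ∑ j : Fin n, if (j : ℕ) < t π then ((π (s π).1).1 (x j) : ℝ) / t π else 0 := by
        rw [eq_sub_iff_add_eq, ← Finset.sum_add_distrib]
        refine (Finset.sum_congr rfl fun j _ => ?_).trans e1
        split_ifs
        · rw [sub_div, sub_add_cancel]
        · simp
      rw [e2]
      simp_rw [mul_sub, mul_one, Finset.sum_sub_distrib]
      rw [hp1]
      ring
  have hDm : ∀ x, Measurable (D x) := fun x =>
    Measurable.sub (Finset.measurable_sum _ fun j _ =>
      Measurable.ite (measurableSet_lt measurable_const ht)
        ((hg (x j)).div (measurable_from_nat.comp ht)) measurable_const)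
      (Finset.measurable_sum _ fun y _ => (hg y).const_mul _)
  have hD1 : ∀ x π, D x π ∈ Set.Icc (-1 : ℝ) 1 := by
    intro x π
    have h1 := evalOn_mem_Icc (π (s π).1).1 (snapshot x (t π))
    have h2 := popValue_mem_Icc (π (s π).1).1 P (t π)
    rw [hD]
    split_ifs <;> constructor <;> linarith [h1.1, h1.2, h2.1, h2.2]
  -- On `B` the signed error exceeds `a`. It splits into response minus empirical mean, at most `α`
  -- off `I x` and at most `1` on it, and empirical minus population mean, which is `D`.
  have hpt : ∀ x, ∀ᵐ π ∂ν x, B.indicator (fun _ => a) π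
      ≤ B.indicator (fun _ => α) π + (I x).indicator (fun _ => 1) π + B.indicator (D x) π := by
    intro x
    filter_upwards [ae_interact_mem_Icc kk σ A x k] with π hπ
    by_cases hπB : π ∈ B
    · simp only [Set.indicator_of_mem hπB]
      have h1 := hBS π hπB
      change a < (if (s π).2 then 1 else -1)
        * ((π (s π).1).2 - popValue (π (s π).1).1 P (t π)) at h1
      have h2 : |(π (s π).1).2 - evalOn (π (s π).1).1 (snapshot x (t π))|
          ≤ α + (I x).indicator (fun _ => 1) π := by
        by_cases hπI : π ∈ I x
        · rw [Set.indicator_of_mem hπI]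
          have h3 := hπ (s π).1
          have h4 := evalOn_mem_Icc (π (s π).1).1 (snapshot x (t π))
          exact abs_le.2 ⟨by linarith [h3.1, h4.2], by linarith [h3.2, h4.1]⟩
        · rw [Set.indicator_of_notMem hπI, add_zero]
          exact not_lt.1 fun hlt => hπI ⟨_, hlt⟩
      rw [hD]
      have h3 := abs_le.1 h2
      split_ifs at h1 ⊢ <;> linarith [h3.1, h3.2]
    · simp only [Set.indicator_of_notMem hπB]
      have : 0 ≤ (I x).indicator (fun _ => (1 : ℝ)) π :=
        Set.indicator_nonneg (fun _ _ => zero_le_one) _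
      linarith
  have hintegr : ∀ x, a * (ν x).real B ≤ α * (ν x).real B + β + ∫ π, B.indicator (D x) π ∂ν x := by
    intro x
    have i1 : Integrable (B.indicator fun _ => a) (ν x) := (integrable_const _).indicator hBm
    have i2 : Integrable (B.indicator fun _ => α) (ν x) := (integrable_const _).indicator hBm
    have i3 : Integrable ((I x).indicator fun _ => (1 : ℝ)) (ν x) :=
      (integrable_const _).indicator (hIm x)
    have i4 : Integrable (B.indicator (D x)) (ν x) :=
      (integrable_of_mem_Icc (hDm x) (hD1 x)).indicator hBm
    have := integral_mono_ae i1 ((i2.add i3).add i4) (hpt x)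
    rw [integral_add' (i2.add i3) i4, integral_add' i2 i3,
      integral_indicator_const _ hBm, integral_indicator_const _ hBm,
      integral_indicator_const _ (hIm x)] at this
    simp only [smul_eq_mul] at this
    linarith [hI x]
  set Pr := ∑ x : Fin n → X, (∏ i, p (x i)) * (ν x).real B with hPr
  have hsum : a * Pr ≤ α * Pr + β
      + ∑ x : Fin n → X, (∏ i, p (x i)) * ∫ π, B.indicator (D x) π ∂ν x := by
    have h1 : β = ∑ x : Fin n → X, (∏ i, p (x i)) * β := by
      rw [← Finset.sum_mul, sum_prod_eq_one hp1, one_mul]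
    rw [h1, hPr, Finset.mul_sum, Finset.mul_sum, ← Finset.sum_add_distrib,
      ← Finset.sum_add_distrib]
    refine Finset.sum_le_sum fun x _ => ?_
    have := mul_le_mul_of_nonneg_left (hintegr x)
      (Finset.prod_nonneg fun i _ => measureReal_nonneg : 0 ≤ ∏ i, p (x i))
    linarith
  have hfin : (a - α - (Real.exp ε - 1)) * Pr
      ≤ β + (∑ j : Fin n, psi γ (rho n₀ n kk (fun _ => σ) (j + 1)) ε) / n₀ := by
    linarith
  have hpos' : 0 < a - α - (Real.exp ε - 1) := pos_of_mul_pos_right (hpos.trans_le h) hb.le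
  exact le_of_mul_le_mul_left (by linarith) hpos'

end Accuracy

/-! ### The optimal order `gammaStar` -/

theorem psi_pos {γ : ℝ} (hγ : 1 < γ) (ρ ε : ℝ) : 0 < psi γ ρ ε := by
  have : 0 < 1 - γ⁻¹ := by
    have := inv_lt_one_of_one_lt₀ hγ
    linarith
  exact div_pos (mul_pos (Real.exp_pos _) (Real.rpow_pos_of_pos this _)) (by linarith)

/-- The logarithm of `psi`. -/
def logPsi (γ ρ ε : ℝ) : ℝ :=
  (γ - 1) * (γ * ρ - ε) + (γ - 1) * Real.log (γ - 1) - γ * Real.log γ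

/-- The derivative of `logPsi` in the order. -/
def logPsiDeriv (γ ρ ε : ℝ) : ℝ :=
  (2 * γ - 1) * ρ - ε + Real.log (γ - 1) - Real.log γ

theorem psi_eq_exp_logPsi {γ : ℝ} (hγ : 1 < γ) (ρ ε : ℝ) :
    psi γ ρ ε = Real.exp (logPsi γ ρ ε) := by
  have h0 : 0 < γ := by linarith
  have h1 : 0 < γ - 1 := by linarith
  have e1 : 1 - γ⁻¹ = (γ - 1) / γ := by field_simp
  rw [psi, e1, Real.rpow_def_of_pos (by positivity), Real.log_div h1.ne' h0.ne', ← Real.exp_add,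
    logPsi]
  conv_lhs => rw [← Real.exp_log h1]
  rw [← Real.exp_sub, Real.exp_log h1]
  congr 1
  ring

theorem hasDerivAt_logPsi {γ : ℝ} (hγ : 1 < γ) (ρ ε : ℝ) :
    HasDerivAt (fun g => logPsi g ρ ε) (logPsiDeriv γ ρ ε) γ := by
  have h0 : γ ≠ 0 := by linarith
  have h1 : γ - 1 ≠ 0 := by linarith
  have d1 : HasDerivAt (fun g : ℝ => g - 1) 1 γ := (hasDerivAt_id γ).sub_const 1
  have d2 : HasDerivAt (fun g : ℝ => g * ρ - ε) (1 * ρ) γ :=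
    ((hasDerivAt_id γ).mul_const ρ).sub_const ε
  have h := ((d1.mul d2).add (d1.mul (d1.log h1))).sub
    ((hasDerivAt_id γ).mul (Real.hasDerivAt_log h0))
  refine h.congr_deriv ?_
  simp only [logPsiDeriv, id]
  field_simp
  ring

/-- Strict convexity of `logPsi` in the order: `log ((γ - 1) / γ)` is strictly increasing, whatever
`ρ ≥ 0` is. -/
theorem strictMonoOn_logPsiDeriv {ρ : ℝ} (hρ : 0 ≤ ρ) (ε : ℝ) :
    StrictMonoOn (fun γ => logPsiDeriv γ ρ ε) (Set.Ioi 1) := by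
  intro a ha b hb hab
  have ha : 1 < a := ha
  have hb : 1 < b := hb
  have h1 : Real.log ((a - 1) / a) < Real.log ((b - 1) / b) := by
    refine Real.log_lt_log (div_pos (by linarith) (by linarith)) ?_
    rw [div_lt_div_iff₀ (by linarith) (by linarith)]
    linarith
  rw [Real.log_div (by linarith) (by linarith), Real.log_div (by linarith) (by linarith)] at h1
  have h2 : (2 * a - 1) * ρ ≤ (2 * b - 1) * ρ := by gcongr
  simp only [logPsiDeriv]
  linarith

theorem exists_logPsiDeriv_eq_zero {ρ ε : ℝ} (hρ : 0 < ρ) (hε : 0 ≤ ε) :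
    ∃ γ, 1 < γ ∧ logPsiDeriv γ ρ ε = 0 := by
  -- Since `1 + s ≤ 2`, the linear term is at most `3 * ρ`, and `log s` outweighs it.
  set s := Real.exp (-(3 * ρ) - 1) with hs
  have hs0 : 0 < s := Real.exp_pos _
  have hs1 : s ≤ 1 := Real.exp_le_one_iff.2 (by linarith)
  have hlog2 := Real.log_pos (by norm_num : (1 : ℝ) < 2)
  -- For `G ≥ 2` the logarithms lose at most `log 2`, and the linear term exceeds `ε + log 2`.
  set G := 2 + (ε + Real.log 2) / ρ with hG
  have hG2 : 2 ≤ G := by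
    have : 0 ≤ (ε + Real.log 2) / ρ := by positivity
    linarith
  have hlow : logPsiDeriv (1 + s) ρ ε ≤ 0 := by
    have h1 : 0 ≤ Real.log (1 + s) := Real.log_nonneg (by linarith)
    have h2 : Real.log (1 + s - 1) = -(3 * ρ) - 1 := by
      rw [add_sub_cancel_left, hs, Real.log_exp]
    have h3 : (2 * (1 + s) - 1) * ρ ≤ 3 * ρ := by gcongr; linarith
    simp only [logPsiDeriv]
    linarith
  have hhigh : 0 ≤ logPsiDeriv G ρ ε := by
    have h1 : Real.log (1 / 2) ≤ Real.log ((G - 1) / G) := by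
      refine Real.log_le_log (by norm_num) ?_
      rw [div_le_div_iff₀ (by norm_num) (by linarith)]
      linarith
    rw [Real.log_div one_ne_zero two_ne_zero, Real.log_one,
      Real.log_div (by linarith) (by linarith)] at h1
    have h2 : (2 * G - 1) * ρ = 3 * ρ + 2 * (ε + Real.log 2) := by
      rw [hG]
      field_simp
      ring
    simp only [logPsiDeriv]
    linarith
  have hcont : ContinuousOn (fun γ => logPsiDeriv γ ρ ε) (Set.Icc (1 + s) G) := by
    intro γ hγ
    have : 1 < γ := by linarith [hγ.1]
    unfold logPsiDeriv
    refine ContinuousAt.continuousWithinAt ?_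
    have h1 : γ - 1 ≠ 0 := by linarith
    have h2 : γ ≠ 0 := by linarith
    fun_prop (disch := assumption)
  obtain ⟨γ, hγ, h0⟩ := intermediate_value_Icc (by linarith) hcont ⟨hlow, hhigh⟩
  exact ⟨γ, by linarith [hγ.1], h0⟩

theorem psi_lt_psi_of_logPsiDeriv_eq_zero {ρ ε γ g : ℝ} (hρ : 0 ≤ ρ) (hγ : 1 < γ)
    (h : logPsiDeriv γ ρ ε = 0) (hg : 1 < g) (hne : g ≠ γ) : psi γ ρ ε < psi g ρ ε := by
  rw [psi_eq_exp_logPsi hγ, psi_eq_exp_logPsi hg, Real.exp_lt_exp]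
  have hmono := strictMonoOn_logPsiDeriv hρ ε
  have hcont : ∀ S ⊆ Set.Ioi (1 : ℝ), ContinuousOn (fun g => logPsi g ρ ε) S := fun S hS u hu =>
    (hasDerivAt_logPsi (hS hu) ρ ε).continuousAt.continuousWithinAt
  rcases lt_or_gt_of_ne hne with hlt | hlt
  · have hsub : Set.Icc g γ ⊆ Set.Ioi 1 := fun u hu => lt_of_lt_of_le hg hu.1
    refine strictAntiOn_of_deriv_neg (convex_Icc g γ) (hcont _ hsub) (fun u hu => ?_)
      (Set.left_mem_Icc.2 hlt.le) (Set.right_mem_Icc.2 hlt.le) hlt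
    rw [interior_Icc] at hu
    have hu1 : 1 < u := hg.trans hu.1
    rw [(hasDerivAt_logPsi hu1 ρ ε).deriv, ← h]
    exact hmono hu1 hγ hu.2
  · have hsub : Set.Icc γ g ⊆ Set.Ioi 1 := fun u hu => lt_of_lt_of_le hγ hu.1
    refine strictMonoOn_of_deriv_pos (convex_Icc γ g) (hcont _ hsub) (fun u hu => ?_)
      (Set.left_mem_Icc.2 hlt.le) (Set.right_mem_Icc.2 hlt.le) hlt
    rw [interior_Icc] at hu
    have hu1 : 1 < u := hγ.trans hu.1
    rw [(hasDerivAt_logPsi hu1 ρ ε).deriv, ← h]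
    exact hmono hγ hu1 hu.1

theorem gammaStar_spec {ρ ε : ℝ} (hρ : 0 < ρ) (hε : 0 ≤ ε) :
    1 < gammaStar ρ ε ∧ logPsiDeriv (gammaStar ρ ε) ρ ε = 0 := by
  obtain ⟨γ, hγ, h0⟩ := exists_logPsiDeriv_eq_zero hρ hε
  have hex : ∃ γ, γ ∈ Set.Ioi (1 : ℝ) ∧ IsMinOn (fun g => psi g ρ ε) (Set.Ioi 1) γ := by
    refine ⟨γ, hγ, fun g hg => ?_⟩
    rcases eq_or_ne g γ with rfl | hne
    · exact le_refl (psi g ρ ε)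
    · exact (psi_lt_psi_of_logPsiDeriv_eq_zero hρ.le hγ h0 hg hne).le
  obtain ⟨h1, h2⟩ := Classical.epsilon_spec hex
  change 1 < gammaStar ρ ε at h1
  change IsMinOn (fun g => psi g ρ ε) (Set.Ioi 1) (gammaStar ρ ε) at h2
  have : gammaStar ρ ε = γ := by
    by_contra hne
    have h3 : psi (gammaStar ρ ε) ρ ε ≤ psi γ ρ ε := h2 hγ
    exact absurd (psi_lt_psi_of_logPsiDeriv_eq_zero hρ.le hγ h0 h1 hne) (not_lt.2 h3)
  exact ⟨h1, this ▸ h0⟩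

/-- For `a > 1`, comparing `a` with `gammaStar` amounts to reading the sign of `logPsiDeriv` at `a`,
and strict signs persist nearby. Monotonicity replaces the implicit function theorem, also at the
boundary `ε = 0`. -/
theorem continuousOn_gammaStar :
    ContinuousOn (fun p : ℝ × ℝ => gammaStar p.1 p.2) (Set.Ioi 0 ×ˢ Set.Ici 0) := by
  rintro ⟨ρ, ε⟩ ⟨hρ, hε⟩
  obtain ⟨h1, h0⟩ := gammaStar_spec hρ hε
  have hcont : ∀ a, ContinuousAt (fun p : ℝ × ℝ => logPsiDeriv a p.1 p.2) (ρ, ε) := by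
    intro a
    unfold logPsiDeriv
    fun_prop
  have hmono := fun {r : ℝ} (hr : 0 < r) e => strictMonoOn_logPsiDeriv hr.le e
  refine tendsto_order.2 ⟨fun a ha => ?_, fun a ha => ?_⟩
  · rcases le_or_gt a 1 with ha1 | ha1
    · filter_upwards [self_mem_nhdsWithin] with p hp
      exact lt_of_le_of_lt ha1 (gammaStar_spec hp.1 hp.2).1
    · have hlt : logPsiDeriv a ρ ε < 0 := h0 ▸ hmono hρ ε ha1 h1 ha
      filter_upwards [self_mem_nhdsWithin,
        mem_nhdsWithin_of_mem_nhds ((hcont a).eventually (gt_mem_nhds hlt))] with p hp hpa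
      obtain ⟨k1, k0⟩ := gammaStar_spec hp.1 hp.2
      refine ((hmono hp.1 p.2).lt_iff_lt ha1 k1).1 ?_
      simp only [k0]
      exact hpa
  · have ha1 : 1 < a := h1.trans ha
    have hlt : 0 < logPsiDeriv a ρ ε := h0 ▸ hmono hρ ε h1 ha1 ha
    filter_upwards [self_mem_nhdsWithin,
      mem_nhdsWithin_of_mem_nhds ((hcont a).eventually (lt_mem_nhds hlt))] with p hp hpa
    obtain ⟨k1, k0⟩ := gammaStar_spec hp.1 hp.2
    refine ((hmono hp.1 p.2).lt_iff_lt k1 ha1).1 ?_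
    simp only [k0]
    exact hpa

theorem continuousOn_gammaStar_comp {Y : Type*} [TopologicalSpace Y] {S : Set Y} {r e : Y → ℝ}
    (hr : ContinuousOn r S) (he : ContinuousOn e S) (hr0 : ∀ y ∈ S, 0 < r y)
    (he0 : ∀ y ∈ S, 0 ≤ e y) : ContinuousOn (fun y => gammaStar (r y) (e y)) S := by
  have h := ContinuousOn.comp (f := fun y => (r y, e y)) continuousOn_gammaStar (hr.prodMk he)
    fun y hy => Set.mk_mem_prod (hr0 y hy) (he0 y hy)
  exact h

theorem continuousAt_psi {q : ℝ × ℝ × ℝ} (hq : 1 < q.1) :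
    ContinuousAt (fun q : ℝ × ℝ × ℝ => psi q.1 q.2.1 q.2.2) q := by
  have h0 : q.1 ≠ 0 := by linarith
  have h1 : q.1 - 1 ≠ 0 := by linarith
  have h2 : 1 - q.1⁻¹ ≠ 0 := by
    have := inv_lt_one_of_one_lt₀ hq
    linarith
  unfold psi
  refine ContinuousAt.div (ContinuousAt.mul (by fun_prop) ?_) (by fun_prop) h1
  exact ContinuousAt.rpow (continuousAt_const.sub (continuousAt_fst.inv₀ h0)) continuousAt_fst
    (Or.inl h2)

theorem continuousOn_psi_comp {Y : Type*} [TopologicalSpace Y] {S : Set Y} {g r e : Y → ℝ}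
    (hg : ContinuousOn g S) (hr : ContinuousOn r S) (he : ContinuousOn e S)
    (hg1 : ∀ y ∈ S, 1 < g y) : ContinuousOn (fun y => psi (g y) (r y) (e y)) S := fun y hy =>
  ContinuousAt.comp_continuousWithinAt (f := fun y => (g y, r y, e y))
    (continuousAt_psi (hg1 y hy)) ((hg.prodMk (hr.prodMk he)) y hy)

/-- With `s = γ - 1`, the bounds `log (s + 1) ≤ s` and `s log s ≥ -1/e` give `logPsi ≥ -1/e`, hence
`psi ≥ 1 - 1/e`. This holds for every order, and excludes small `σ` when `λ < 1`. -/
theorem half_lt_psi {γ ρ ε : ℝ} (hγ : 1 < γ) (hρ1 : 1 ≤ ρ) (hρ : ε + 1 ≤ ρ) :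
    1 / 2 < psi γ ρ ε := by
  set s := γ - 1 with hs
  have hs0 : 0 < s := by linarith
  have hγs : γ = s + 1 := by ring
  have h1 : Real.log (s + 1) ≤ s := by
    have := Real.log_le_sub_one_of_pos (by linarith : 0 < s + 1)
    linarith
  have h2 : -Real.exp (-1) ≤ s * Real.log s := by
    have h := Real.log_le_sub_one_of_pos (div_pos (Real.exp_pos (-1)) hs0)
    rw [Real.log_div (Real.exp_pos _).ne' hs0.ne', Real.log_exp] at h
    have h' : -Real.log s ≤ Real.exp (-1) / s := by linarith
    rw [le_div_iff₀ hs0] at h'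
    linarith
  have h3 : -Real.exp (-1) ≤ logPsi γ ρ ε := by
    rw [logPsi, ← hs, hγs]
    have h4 : (s + 1) * Real.log (s + 1) ≤ (s + 1) * s := by gcongr
    have h5 : 0 ≤ s * (ρ - 1 - ε) := mul_nonneg hs0.le (by linarith)
    have h6 : 0 ≤ s * (s * (ρ - 1)) := mul_nonneg hs0.le (mul_nonneg hs0.le (by linarith))
    linarith
  rw [psi_eq_exp_logPsi hγ]
  have h4 : Real.exp (-1) < 1 / 2 := by
    rw [Real.exp_neg, ← one_div]
    exact one_div_lt_one_div_of_lt (by norm_num) (by linarith [Real.exp_one_gt_d9])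
  have h5 := Real.add_one_le_exp (logPsi γ ρ ε)
  linarith

/-! ### The parameters of the error bound -/

theorem rho_eq_div (n₀ n : ℕ) (kk : ℕ → ℕ) (σ : ℝ) (t : ℕ) :
    rho n₀ n kk (fun _ => σ) t = rho n₀ n kk (fun _ => 1) t / σ ^ 2 := by
  rw [rho, rho, Finset.sum_div]
  refine Finset.sum_congr rfl fun τ _ => ?_
  rw [div_div]
  congr 1
  ring

theorem rho_antitone (n₀ n : ℕ) (kk : ℕ → ℕ) (σ : ℕ → ℝ) : Antitone (rho n₀ n kk σ) := by
  intro s t hst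
  refine Finset.sum_le_sum fun τ _ => ?_
  gcongr ?_ / _
  gcongr
  split_ifs <;> first | omega | norm_num

theorem sSup_rho {n : ℕ} (hn : 1 ≤ n) (n₀ : ℕ) (kk : ℕ → ℕ) (σ : ℕ → ℝ) :
    sSup (rho n₀ n kk σ '' Set.Icc 1 n) = rho n₀ n kk σ 1 :=
  IsGreatest.csSup_eq ⟨⟨1, ⟨le_rfl, hn⟩, rfl⟩, by
    rintro _ ⟨t, ht, rfl⟩
    exact rho_antitone n₀ n kk σ ht.1⟩

/-- The first `n₀` data points belong to every snapshot. -/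
theorem rho_eq_rho_one {n₀ t : ℕ} (ht1 : 1 ≤ t) (ht : t ≤ n₀) (n : ℕ) (kk : ℕ → ℕ) (σ : ℕ → ℝ) :
    rho n₀ n kk σ t = rho n₀ n kk σ 1 := by
  refine Finset.sum_congr rfl fun τ hτ => ?_
  have := (Finset.mem_Icc.1 hτ).1
  rw [if_pos (by omega), if_pos (by omega)]

theorem rho_one_pos {n₀ n : ℕ} (hn₀ : 1 ≤ n₀) {kk : ℕ → ℕ} (hk : 1 ≤ totalQueries n₀ n kk)
    {σ : ℝ} (hσ : 0 < σ) : 0 < rho n₀ n kk (fun _ => σ) 1 := by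
  obtain ⟨τ, hτ, hne⟩ : ∃ τ ∈ Finset.Icc n₀ n, kk τ ≠ 0 := by
    by_contra! hcon
    rw [totalQueries, Finset.sum_eq_zero hcon] at hk
    omega
  refine Finset.sum_pos' (fun τ _ => by positivity) ⟨τ, hτ, ?_⟩
  have h1 : 1 ≤ τ := hn₀.trans (Finset.mem_Icc.1 hτ).1
  rw [if_pos h1]
  have h2 : 0 < kk τ := Nat.pos_of_ne_zero hne
  positivity

section ErrBound

variable {n₀ n : ℕ} {kk : ℕ → ℕ}

theorem delta_eq (hn : 1 ≤ n) (σ ε : ℝ) (t : ℕ) :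
    delta n₀ n kk (fun _ => σ) ε t = psi (gammaStar (rho n₀ n kk (fun _ => σ) 1) ε)
      (rho n₀ n kk (fun _ => σ) t) ε := by
  rw [delta, sSup_rho hn]

theorem delta_pos (hn₀ : 1 ≤ n₀) (hn : n₀ ≤ n) (hk : 1 ≤ totalQueries n₀ n kk) {σ ε : ℝ}
    (hσ : 0 < σ) (hε : 0 ≤ ε) (t : ℕ) : 0 < delta n₀ n kk (fun _ => σ) ε t := by
  rw [delta_eq (hn₀.trans hn)]
  exact psi_pos (gammaStar_spec (rho_one_pos hn₀ hk hσ) hε).1 _ _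

theorem sum_delta_pos (hn₀ : 1 ≤ n₀) (hn : n₀ ≤ n) (hk : 1 ≤ totalQueries n₀ n kk) {σ ε : ℝ}
    (hσ : 0 < σ) (hε : 0 ≤ ε) : 0 < ∑ τ ∈ Finset.Icc 1 n, delta n₀ n kk (fun _ => σ) ε τ :=
  Finset.sum_pos (fun τ _ => delta_pos hn₀ hn hk hσ hε τ) ⟨1, by simp; omega⟩

/-- The first `n₀` data points share one `δ`, which compensates the `1 / n₀` in `λ`. -/
theorem mul_delta_one_le_sum (hn₀ : 1 ≤ n₀) (hn : n₀ ≤ n) (hk : 1 ≤ totalQueries n₀ n kk)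
    {σ ε : ℝ} (hσ : 0 < σ) (hε : 0 ≤ ε) :
    n₀ * delta n₀ n kk (fun _ => σ) ε 1
      ≤ ∑ τ ∈ Finset.Icc 1 n, delta n₀ n kk (fun _ => σ) ε τ := by
  have hconst : ∀ τ ∈ Finset.Icc 1 n₀,
      delta n₀ n kk (fun _ => σ) ε τ = delta n₀ n kk (fun _ => σ) ε 1 := by
    intro τ hτ
    rw [Finset.mem_Icc] at hτ
    rw [delta, delta, rho_eq_rho_one hτ.1 hτ.2]
  calc n₀ * delta n₀ n kk (fun _ => σ) ε 1
      = ∑ τ ∈ Finset.Icc 1 n₀, delta n₀ n kk (fun _ => σ) ε τ := by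
        rw [Finset.sum_congr rfl hconst, Finset.sum_const, Nat.card_Icc, nsmul_eq_mul,
          add_tsub_cancel_right]
    _ ≤ _ := Finset.sum_le_sum_of_subset_of_nonneg (Finset.Icc_subset_Icc_right hn)
        fun τ _ _ => (delta_pos hn₀ hn hk hσ hε τ).le

theorem continuousOn_delta (hn₀ : 1 ≤ n₀) (hn : n₀ ≤ n) (hk : 1 ≤ totalQueries n₀ n kk) (t : ℕ) :
    ContinuousOn (fun p : ℝ × ℝ × ℝ => delta n₀ n kk (fun _ => p.1) p.2.2 t) Theta := by
  have hrho : ∀ t, ContinuousOn (fun p : ℝ × ℝ × ℝ => rho n₀ n kk (fun _ => p.1) t) Theta := by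
    intro t
    have : ContinuousOn (fun p : ℝ × ℝ × ℝ => rho n₀ n kk (fun _ => 1) t / p.1 ^ 2) Theta :=
      continuousOn_const.div (by fun_prop) fun p hp => (pow_pos hp.1 2).ne'
    exact this.congr fun p _ => rho_eq_div n₀ n kk p.1 t
  have hε : ContinuousOn (fun p : ℝ × ℝ × ℝ => p.2.2) Theta := by fun_prop
  have hγ : ContinuousOn (fun p : ℝ × ℝ × ℝ =>
      gammaStar (rho n₀ n kk (fun _ => p.1) 1) p.2.2) Theta :=
    continuousOn_gammaStar_comp (hrho 1) hε (fun p hp => rho_one_pos hn₀ hk hp.1)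
      fun p hp => hp.2.2
  have hpsi := continuousOn_psi_comp hγ (hrho t) hε fun p hp =>
    (gammaStar_spec (rho_one_pos hn₀ hk hp.1) hp.2.2).1
  exact hpsi.congr fun p _ => delta_eq (hn₀.trans hn) p.1 p.2.2 t

theorem div_totalQueries_mem_Ioo (hk : 1 ≤ totalQueries n₀ n kk) {β : ℝ}
    (hβ : β ∈ Set.Ioo (0 : ℝ) 1) : β / totalQueries n₀ n kk ∈ Set.Ioo (0 : ℝ) 1 := by
  have hk' : (1 : ℝ) ≤ totalQueries n₀ n kk := by exact_mod_cast hk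
  exact ⟨div_pos hβ.1 (by linarith), (div_lt_one (by linarith)).2 (by linarith [hβ.2])⟩

theorem continuousOn_errBound (hn₀ : 1 ≤ n₀) (hn : n₀ ≤ n) (hk : 1 ≤ totalQueries n₀ n kk)
    (β' : ℝ) : ContinuousOn (errBound n₀ n kk β') Theta := by
  have hsum : ContinuousOn (fun p : ℝ × ℝ × ℝ =>
      ∑ τ ∈ Finset.Icc 1 n, delta n₀ n kk (fun _ => p.1) p.2.2 τ) Theta :=
    continuousOn_finsetSum _ fun τ _ => continuousOn_delta hn₀ hn hk τ
  have herfc : ContinuousOn (fun p : ℝ × ℝ × ℝ => erfcInv (p.2.1 / totalQueries n₀ n kk))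
      Theta := fun p hp =>
    ContinuousAt.comp_continuousWithinAt (g := erfcInv)
      (f := fun p : ℝ × ℝ × ℝ => p.2.1 / totalQueries n₀ n kk)
      (continuousAt_erfcInv (div_totalQueries_mem_Ioo hk hp.2.1)) (by fun_prop)
  unfold errBound
  fun_prop

theorem box_subset_Theta {σ₀ σ₁ β₀ β₁ ε₁ : ℝ} (hσ : 0 < σ₀) (hβ₀ : 0 < β₀)
    (hβ₁ : β₁ < 1) : Set.Icc σ₀ σ₁ ×ˢ Set.Icc β₀ β₁ ×ˢ Set.Icc 0 ε₁ ⊆ Theta :=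
  fun _ hp => ⟨hσ.trans_le hp.1.1, ⟨hβ₀.trans_le hp.2.1.1, hp.2.1.2.trans_lt hβ₁⟩, hp.2.2.1⟩

/-! ### Attainment of the infimum, and accuracy at given parameters -/

/-- The parameters with a nontrivial error bound lie in a compact set. -/
theorem exists_isCompact_of_errBound_lt_one (hn₀ : 1 ≤ n₀) (hn : n₀ ≤ n)
    (hk : 1 ≤ totalQueries n₀ n kk) {β' : ℝ} (hβ' : β' ∈ Set.Ioo (0 : ℝ) 1) :
    ∃ K ⊆ Theta, IsCompact K ∧ ∀ p ∈ Theta, errBound n₀ n kk β' p < 1 → p ∈ K := by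
  have hk' : (1 : ℝ) ≤ totalQueries n₀ n kk := by exact_mod_cast hk
  have hn₀' : (0 : ℝ) < n₀ := by exact_mod_cast hn₀
  have hr : 0 < rho n₀ n kk (fun _ => 1) 1 := rho_one_pos hn₀ hk one_pos
  -- Below `σ₀` the parameter `rho` at the first data point exceeds `2`, which will force `δ > 1 /
  -- 2`.
  set σ₀ := √(rho n₀ n kk (fun _ => 1) 1 / 2) with hσ₀
  have hσ₀pos : 0 < σ₀ := Real.sqrt_pos.2 (by positivity)
  have hu : 0 < erfcInv β' := erfcInv_pos hβ'
  refine ⟨Set.Icc σ₀ (1 / (√2 * erfcInv β')) ×ˢ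
    Set.Icc (erfc (1 / (√2 * σ₀))) β' ×ˢ Set.Icc 0 1,
    box_subset_Theta hσ₀pos (erfc_pos _) hβ'.2,
    isCompact_Icc.prod (isCompact_Icc.prod isCompact_Icc), ?_⟩
  rintro ⟨σ, β, ε⟩ ⟨hσ, hβ, hε⟩ hlt
  simp only at hσ hβ hε
  have hbk := div_totalQueries_mem_Ioo hk hβ
  have hsum := sum_delta_pos hn₀ hn hk hσ hε
  have hsum1 := mul_delta_one_le_sum hn₀ hn hk hσ hε
  simp only [errBound] at hlt
  set D := ∑ τ ∈ Finset.Icc 1 n, delta n₀ n kk (fun _ => σ) ε τ with hD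
  set u := erfcInv (β / totalQueries n₀ n kk) with hu'
  have hupos : 0 < u := erfcInv_pos hbk
  -- No part of the bound is negative, so each one is below `1`.
  have t1 : 0 < √2 * σ * u := by positivity
  have t2 : 0 ≤ Real.exp ε - 1 := by linarith [Real.one_le_exp hε]
  have t3 : 0 < β / β' := div_pos hβ.1 hβ'.1
  have t4 : 0 < 2 * D / (n₀ * β') := div_pos (by positivity) (mul_pos hn₀' hβ'.1)
  have t5 : 0 ≤ 2 / β' * √(2 * β * D / n₀) :=
    mul_nonneg (div_nonneg zero_le_two hβ'.1.le) (Real.sqrt_nonneg _)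
  have hε1 : ε ≤ 1 := by linarith [Real.add_one_le_exp ε]
  have hβ1 : β ≤ β' := by
    rw [← div_le_one hβ'.1]
    linarith
  have hbk' : β / totalQueries n₀ n kk ≤ β := div_le_self hβ.1.le hk'
  have hu1 : erfcInv β' ≤ u := by
    rw [← strictAnti_erfc.le_iff_ge, hu', erfc_erfcInv hbk, erfc_erfcInv hβ']
    linarith
  have hs2 : 0 < √(2 : ℝ) := by positivity
  have hσ1 : σ ≤ 1 / (√2 * erfcInv β') := by
    rw [le_div_iff₀ (by positivity)]
    calc σ * (√2 * erfcInv β') = √2 * σ * erfcInv β' := by ring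
      _ ≤ √2 * σ * u := by gcongr
      _ ≤ 1 := by linarith
  have hdel : delta n₀ n kk (fun _ => σ) ε 1 < 1 / 2 := by
    have h1 : 2 * D / (n₀ * β') < 1 := by linarith
    rw [div_lt_one (mul_pos hn₀' hβ'.1)] at h1
    have h2 : n₀ * β' < n₀ * 1 := by
      gcongr
      exact hβ'.2
    have h3 : n₀ * (2 * delta n₀ n kk (fun _ => σ) ε 1) < n₀ * 1 := by linarith
    linarith [lt_of_mul_lt_mul_left h3 hn₀'.le]
  have hrho : rho n₀ n kk (fun _ => σ) 1 < 2 := by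
    by_contra! hge
    rw [delta_eq (hn₀.trans hn)] at hdel
    exact absurd (half_lt_psi (gammaStar_spec (rho_one_pos hn₀ hk hσ) hε).1 (by linarith)
      (by linarith)) (not_lt.2 hdel.le)
  have hσ0 : σ₀ ≤ σ := by
    rw [rho_eq_div, div_lt_iff₀ (by positivity)] at hrho
    rw [hσ₀, Real.sqrt_le_left hσ.le]
    linarith
  refine ⟨⟨hσ0, hσ1⟩, ⟨?_, hβ1⟩, hε, hε1⟩
  -- The lower bound on `σ` caps `erfcInv (β / k)`, which keeps `β / k`, and with it `β`, away from
  -- `0`.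
  have hu2 : u ≤ 1 / (√2 * σ₀) := by
    rw [le_div_iff₀ (by positivity)]
    calc u * (√2 * σ₀) = √2 * σ₀ * u := by ring
      _ ≤ √2 * σ * u := by gcongr
      _ ≤ 1 := by linarith
  have := strictAnti_erfc.antitone hu2
  rw [hu', erfc_erfcInv hbk] at this
  exact this.trans hbk'

theorem exists_errBound_eq_sInf (hn₀ : 1 ≤ n₀) (hn : n₀ ≤ n) (hk : 1 ≤ totalQueries n₀ n kk)
    {β' : ℝ} (hβ' : β' ∈ Set.Ioo (0 : ℝ) 1) (h : sInf (errBound n₀ n kk β' '' Theta) < 1) :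
    ∃ p ∈ Theta, errBound n₀ n kk β' p = sInf (errBound n₀ n kk β' '' Theta) := by
  obtain ⟨K, hKT, hK, hmem⟩ := exists_isCompact_of_errBound_lt_one hn₀ hn hk hβ'
  have hne : (errBound n₀ n kk β' '' Theta).Nonempty :=
    ⟨_, (1, 1 / 2, 0), ⟨one_pos, ⟨by norm_num, by norm_num⟩, le_rfl⟩, rfl⟩
  obtain ⟨_, ⟨p₀, hp₀, rfl⟩, hlt⟩ := exists_lt_of_csInf_lt hne h
  obtain ⟨p, hpK, hp⟩ := hK.exists_isMinOn ⟨p₀, hmem p₀ hp₀ hlt⟩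
    ((continuousOn_errBound hn₀ hn hk β').mono hKT)
  -- Outside `K` the bound is at least `1`, above its value at `p₀`, so the minimum over `K` is
  -- global. This also shows that the set of values is bounded below.
  suffices hmin : IsLeast (errBound n₀ n kk β' '' Theta) (errBound n₀ n kk β' p) from
    ⟨p, hKT hpK, hmin.csInf_eq.symm⟩
  refine ⟨⟨p, hKT hpK, rfl⟩, ?_⟩
  rintro _ ⟨q, hq, rfl⟩
  rcases lt_or_ge (errBound n₀ n kk β' q) 1 with hq1 | hq1
  · exact isMinOn_iff.1 hp q (hmem q hq hq1)
  · exact (isMinOn_iff.1 hp p₀ (hmem p₀ hp₀ hlt)).trans (hlt.le.trans hq1)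

theorem distAccurate_errBound {X : Type*} [Finite X] [MeasurableSpace X]
    [MeasurableSingletonClass X] (hn₀ : 1 ≤ n₀) (hn : n₀ ≤ n) (hk : 1 ≤ totalQueries n₀ n kk)
    {β' : ℝ} (hβ' : β' ∈ Set.Ioo (0 : ℝ) 1) {σ β ε : ℝ} (h : (σ, β, ε) ∈ Theta) :
    DistAccurate (clippedGaussian X fun _ => σ) n₀ n kk
      (fun _ => errBound n₀ n kk β' (σ, β, ε)) β' := by
  obtain ⟨hσ, hβ, hε⟩ := h
  simp only at hσ hβ hε
  have hn₀' : (0 : ℝ) < n₀ := by exact_mod_cast hn₀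
  have hsum := sum_delta_pos hn₀ hn hk hσ hε
  have hre : ∑ j : Fin n, psi (gammaStar (rho n₀ n kk (fun _ => σ) 1) ε)
        (rho n₀ n kk (fun _ => σ) (j + 1)) ε
      = ∑ τ ∈ Finset.Icc 1 n, delta n₀ n kk (fun _ => σ) ε τ := by
    rw [Fin.sum_univ_eq_sum_range (fun j => psi (gammaStar (rho n₀ n kk (fun _ => σ) 1) ε)
      (rho n₀ n kk (fun _ => σ) (j + 1)) ε) n, Finset.range_eq_Ico,
      Finset.sum_Ico_add' (fun j => psi (gammaStar (rho n₀ n kk (fun _ => σ) 1) ε)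
        (rho n₀ n kk (fun _ => σ) j) ε) 0 n 1]
    refine Finset.sum_congr ?_ fun τ _ => (delta_eq (hn₀.trans hn) σ ε τ).symm
    ext τ
    simp only [Finset.mem_Ico, Finset.mem_Icc]
    omega
  have hd : 0 < (∑ τ ∈ Finset.Icc 1 n, delta n₀ n kk (fun _ => σ) ε τ) / n₀ := by positivity
  refine distAccurate_clippedGaussian hn₀ hn kk hk hσ hβ hε
    (gammaStar_spec (rho_one_pos hn₀ hk hσ) hε).1 ?_ ?_ hβ'.1
  · rw [hre]
    linarith [hβ.1]
  · rw [hre]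
    simp only [errBound]
    have hb := hβ'.1.ne'
    have hsq : 0 ≤ √(2 * β * (∑ τ ∈ Finset.Icc 1 n, delta n₀ n kk (fun _ => σ) ε τ) / n₀) :=
      Real.sqrt_nonneg _
    generalize √(2 * β * (∑ τ ∈ Finset.Icc 1 n, delta n₀ n kk (fun _ => σ) ε τ) / n₀) = r at *
    generalize ∑ τ ∈ Finset.Icc 1 n, delta n₀ n kk (fun _ => σ) ε τ = D at *
    -- Only `β + D / n₀` is required; `D / n₀ + 2 * r` is left over.
    have e : β' * (√2 * σ * erfcInv (β / totalQueries n₀ n kk) + Real.exp ε - 1 + β / β'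
          + 2 * D / (n₀ * β') + 2 / β' * r
          - √2 * σ * erfcInv (β / totalQueries n₀ n kk) - (Real.exp ε - 1))
        = β + 2 * (D / n₀) + 2 * r := by
      field_simp
      ring
    rw [e]
    linarith

end ErrBound

end GrowingADA

end

/-! ### The main theorem -/

theorem mainTheorem6 {X : Type*} [Finite X] [MeasurableSpace X] [MeasurableSingletonClass X]
    (n₀ n : ℕ) (hn₀ : 1 ≤ n₀) (hn : n₀ ≤ n)
    (kk : ℕ → ℕ) (hk : 1 ≤ GrowingADA.totalQueries n₀ n kk)
    (β' : ℝ) (hβ' : β' ∈ Set.Ioo (0 : ℝ) 1) (α' : ℝ)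
    (hα' : α' = sInf (GrowingADA.errBound n₀ n kk β' '' GrowingADA.Theta)) :
    (∀ σ β ε : ℝ, (σ, β, ε) ∈ GrowingADA.Theta →
      GrowingADA.DistAccurate (GrowingADA.clippedGaussian X fun _ => σ) n₀ n kk
        (fun _ => GrowingADA.errBound n₀ n kk β' (σ, β, ε)) β') ∧
    (α' < 1 → ∃ p ∈ GrowingADA.Theta, GrowingADA.errBound n₀ n kk β' p = α') ∧
    (∃ σ : ℝ, 0 < σ ∧
      GrowingADA.DistAccurate (GrowingADA.clippedGaussian X fun _ => σ) n₀ n kk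
        (fun _ => α') β') := by
  subst hα'
  refine ⟨fun σ β ε h => GrowingADA.distAccurate_errBound hn₀ hn hk hβ' h,
    GrowingADA.exists_errBound_eq_sInf hn₀ hn hk hβ', ?_⟩
  rcases lt_or_ge (sInf (GrowingADA.errBound n₀ n kk β' '' GrowingADA.Theta)) 1 with hlt | hge
  · obtain ⟨⟨σ, β, ε⟩, hp, heq⟩ := GrowingADA.exists_errBound_eq_sInf hn₀ hn hk hβ' hlt
    rw [← heq]
    exact ⟨σ, hp.1, GrowingADA.distAccurate_errBound hn₀ hn hk hβ' hp⟩
  -- Any `σ > 0` would do: an error bound of at least `1` is met by every clipped answer.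
  · exact ⟨1, one_pos, GrowingADA.distAccurate_of_one_le hn₀ kk 1 hge hβ'.1.le⟩
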